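/- **Single-cycle conference with time-sharing estimate-and-forward.** Let $(\mathcal X, p(y_1,y_2|x), \mathcal Y_1\times\mathcal Y_2)$ be a discrete memoryless broadcast channel with finite alphabets ($\mathcal X\ne\emptyset$), and let $C_{12}, C_{21}\ge 0$. A transmitter sends one common message $M$, uniform on $\{1,\dots,\lceil 2^{nR}\rceil\}$, to both receivers, as a codeword in $\mathcal X^n$. After receiving $Y_1^n$, resp. $Y_2^n$, the receivers hold a single-cycle conference over noiseless links: if receiver 1 starts, it sends a function of $Y_1^n$ with $\lfloor 2^{nC_{12}}\rfloor$ possible values to receiver 2, which answers with a function of $Y_2^n$ and the received message with $\lfloor 2^{nC_{21}}\rfloor$ possible values; if receiver 2 starts, the roles are exchanged. Then each receiver decodes $M$ from its channel output and the received conference message. A rate $R$ is achievable (for a given order) if there are such codes for all $n$ for which the average probability that at least one receiver decodes wrongly tends to $0$ as $n\to\infty$; as usual, a number $R^*$ is called an achievable rate if every $R<R^*$ is achievable in this sense. For an input distribution $p(x)$ let $(X,Y_1,Y_2)\sim p(x)p(y_1,y_2|x)$, write $[t]^*=\min(t,1)$, and set (information measures in bits) $$R_{12}(p)=\min\Big\{I(X;Y_1)+C_{21},\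 I(X;Y_2)+\Big[\tfrac{C_{12}}{H(Y_1|Y_2)}\Big]^*I(X;Y_1|Y_2)\Big\},$$ $$R_{21}(p)=\min\Big\{I(X;Y_1)+\Big[\tfrac{C_{21}}{H(Y_2|Y_1)}\Big]^*I(X;Y_2|Y_1),\ I(X;Y_2)+C_{12}\Big\},$$ where a product whose quotient has denominator $0$ is read as $0$ (its other factor is then $0$). 1. For every $p(x)$, $R_{12}(p)$ is the largest value of $\min\{I(X;Y_1)+\alpha C_{21},\ I(X;Y_2,\hat Y_1)\}$ over $\alpha\in[0,1]$ and over the erasure assignments $p(\hat y_1|y_1)$ ($\hat y_1=y_1$ with probability $q\in[0,1]$, and $\hat y_1=\Omega\notin\mathcal Y_1$ with probability $1-q$) that satisfy $C_{12}\ge I(Y_1;\hat Y_1|Y_2)$ and $(1-\alpha)C_{21}\ge I(Y_2;\hat Y_1|Y_1)$. Symmetrically, with the receivers exchanged, for $R_{21}(p)$. 2. The rate $R=\sup_{p(x)}\min\{R_{12}(p),R_{21}(p)\}$ is finite and is achievable with a single conference cycle, whichever receiver starts. 3. More precisely, $\sup_{p(x)}R_{12}(p)$ is finite and achievable with a single cycle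 started by receiver 1, and $\sup_{p(x)}R_{21}(p)$ is finite and achievable with a single cycle started by receiver 2. Hence every rate below $\sup_{p(x)}\max\{R_{12}(p),R_{21}(p)\}$ is achievable for at least one of the two orders. -/

import Mathlib

noncomputable section

namespace CoopBC

/-! Information measures (in bits) of random variables on a finite space `Ω` with law `μ`. -/

section Information

variable {Ω α β γ : Type*} [Fintype Ω] [Fintype α] [Fintype β] [Fintype γ]

open Classical in
/-- The distribution of the random variable `A` under `μ`: `law μ A a = Pr(A = a)`. -/
def law (μ : Ω → ℝ) (A : Ω → α) (a : α) : ℝ :=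
  ∑ ω, if A ω = a then μ ω else 0

/-- Shannon entropy `H(A)`. -/
def entropy (μ : Ω → ℝ) (A : Ω → α) : ℝ :=
  -∑ a, law μ A a * Real.logb 2 (law μ A a)

/-- Conditional entropy `H(A|B) = -∑ p(a,b) log p(a|b)`. -/
def condEntropy (μ : Ω → ℝ) (A : Ω → α) (B : Ω → β) : ℝ :=
  -∑ a, ∑ b, law μ (fun ω => (A ω, B ω)) (a, b) *
    Real.logb 2 (law μ (fun ω => (A ω, B ω)) (a, b) / law μ B b)

/-- Mutual information `I(A;B) = H(A) - H(A|B)`. -/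
def mutualInfo (μ : Ω → ℝ) (A : Ω → α) (B : Ω → β) : ℝ :=
  entropy μ A - condEntropy μ A B

/-- Conditional mutual information `I(A;B|C) = H(A|C) - H(A|B,C)`. -/
def condMutualInfo (μ : Ω → ℝ) (A : Ω → α) (B : Ω → β) (C : Ω → γ) : ℝ :=
  condEntropy μ A C - condEntropy μ A (fun ω => (B ω, C ω))

end Information

/-- `[x]^* = min(x, 1)`. -/
def clip (x : ℝ) : ℝ := min x 1

/-! The joint law of input and outputs, and the single-cycle rates. In this part `Y` is the output
of the receiver that sends the first conference message (over a link of capacity `C`), and `Z` is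
the output of the other receiver, which answers over a link of capacity `C'`. -/

section Rates

variable {𝓧 𝓨₁ 𝓨₂ : Type*}

/-- The joint law `p(x) p(y₁,y₂|x)`. -/
def jointLaw (W : 𝓧 → 𝓨₁ × 𝓨₂ → ℝ) (p : 𝓧 → ℝ) : 𝓧 × 𝓨₁ × 𝓨₂ → ℝ :=
  fun ω => p ω.1 * W ω.1 ω.2

variable {Ω α β γ : Type*} [Fintype Ω] [Fintype α] [Fintype β] [Fintype γ]

/-- `min {I(X;Y) + C', I(X;Z) + [C / H(Y|Z)]^* I(X;Y|Z)}`. If `H(Y|Z) = 0` then `I(X;Y|Z) = 0`, so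
the value given to the quotient is immaterial. -/
def tsRate (μ : Ω → ℝ) (X : Ω → α) (Y : Ω → β) (Z : Ω → γ) (C C' : ℝ) : ℝ :=
  min (mutualInfo μ X Y + C')
    (mutualInfo μ X Z + clip (C / condEntropy μ Y Z) * condMutualInfo μ X Y Z)

open Classical in
/-- The erasure (time-sharing) assignment `p(ŷ|y)`: `ŷ = y` with probability `q` and
`ŷ` is the extra symbol `none` with probability `1 - q`. -/
def erasure (q : ℝ) (y : β) : Option β → ℝ
  | some y' => if y' = y then q else 0
  | none => 1 - q

/-- The law of `(ω, Ŷ)`, where `Ŷ` is obtained from `Y` by the erasure assignment. -/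
def erasureLaw (μ : Ω → ℝ) (Y : Ω → β) (q : ℝ) : Ω × Option β → ℝ :=
  fun ω => μ ω.1 * erasure q (Y ω.1) ω.2

/-- The values `min {I(X;Y) + α C', I(X;Z,Ŷ)}` of the one-cycle estimate-and-forward rate expression
at the erasure assignments that meet the constraints `I(Y;Ŷ|Z) ≤ C` and
`I(Z;Ŷ|Y) ≤ (1 - α) C'`. -/
def eafValues (μ : Ω → ℝ) (X : Ω → α) (Y : Ω → β) (Z : Ω → γ) (C C' : ℝ) : Set ℝ :=
  {r | ∃ q ∈ Set.Icc (0 : ℝ) 1, ∃ a ∈ Set.Icc (0 : ℝ) 1,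
    condMutualInfo (erasureLaw μ Y q) (fun ω => Y ω.1) (fun ω => ω.2) (fun ω => Z ω.1) ≤ C ∧
    condMutualInfo (erasureLaw μ Y q) (fun ω => Z ω.1) (fun ω => ω.2) (fun ω => Y ω.1)
      ≤ (1 - a) * C' ∧
    r = min
      (mutualInfo (erasureLaw μ Y q) (fun ω => X ω.1) (fun ω => Y ω.1) + a * C')
      (mutualInfo (erasureLaw μ Y q) (fun ω => X ω.1) (fun ω => (Z ω.1, ω.2)))}

variable [Fintype 𝓧] [Fintype 𝓨₁] [Fintype 𝓨₂]

/-- `R₁₂` at input distribution `p`. -/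
def R12 (W : 𝓧 → 𝓨₁ × 𝓨₂ → ℝ) (C₁₂ C₂₁ : ℝ) (p : 𝓧 → ℝ) : ℝ :=
  tsRate (jointLaw W p) (fun ω => ω.1) (fun ω => ω.2.1) (fun ω => ω.2.2) C₁₂ C₂₁

/-- `R₂₁` at input distribution `p`: the two receivers exchange their roles. -/
def R21 (W : 𝓧 → 𝓨₁ × 𝓨₂ → ℝ) (C₁₂ C₂₁ : ℝ) (p : 𝓧 → ℝ) : ℝ :=
  tsRate (jointLaw W p) (fun ω => ω.1) (fun ω => ω.2.2) (fun ω => ω.2.1) C₂₁ C₁₂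

end Rates

/-! Codes with a single conference cycle. -/

section Codes

variable {𝓧 𝓐 𝓑 : Type*}

/-- A code of length `n` with `M` common messages and a one-cycle conference which the receiver
observing `𝓐ⁿ` starts: it sends one of `N` messages, and the receiver observing `𝓑ⁿ` answers with
one of `N'` messages. After that both decode. -/
structure Code (𝓧 𝓐 𝓑 : Type*) (n M N N' : ℕ) where
  /-- the encoder -/
  enc : Fin M → Fin n → 𝓧
  /-- the first conference message -/
  h : (Fin n → 𝓐) → Fin N
  /-- the second conference message -/
  h' : (Fin n → 𝓑) → Fin N → Fin N'
  /-- the decoder of the receiver that starts the conference -/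
  dec : Fin N' → (Fin n → 𝓐) → Fin M
  /-- the decoder of the other receiver -/
  dec' : Fin N → (Fin n → 𝓑) → Fin M

/-- With message `m` and channel outputs `y`, both receivers decode correctly. -/
def Code.Correct {n M N N' : ℕ} (c : Code 𝓧 𝓐 𝓑 n M N N') (m : Fin M) (y : Fin n → 𝓐 × 𝓑) : Prop :=
  let a := fun i => (y i).1
  let b := fun i => (y i).2
  c.dec (c.h' b (c.h a)) a = m ∧ c.dec' (c.h a) b = m

open Classical in
/-- The average probability, over the memoryless channel `W` and a uniform message, that at least
one receiver errs. -/
def Code.errProb {n M N N' : ℕ} [Fintype 𝓐] [Fintype 𝓑] (c : Code 𝓧 𝓐 𝓑 n M N N')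
    (W : 𝓧 → 𝓐 × 𝓑 → ℝ) : ℝ :=
  (1 / (M : ℝ)) * ∑ m : Fin M, ∑ y : Fin n → 𝓐 × 𝓑,
    if c.Correct m y then 0 else ∏ i, W (c.enc m i) (y i)

/-- `R` is achievable with a single conference cycle which the first receiver starts: there are
`(2^{nR}, n)` codes (with `2^{nR}` rounded up), with conference messages from sets of sizes
`2^{nC}` and `2^{nC'}` (rounded down), whose average error probability tends to `0`. -/
def Achievable [Fintype 𝓐] [Fintype 𝓑] (W : 𝓧 → 𝓐 × 𝓑 → ℝ) (C C' R : ℝ) : Prop :=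
  ∃ c : ∀ n : ℕ, Code 𝓧 𝓐 𝓑 n ⌈(2 : ℝ) ^ (n * R)⌉₊ ⌊(2 : ℝ) ^ (n * C)⌋₊ ⌊(2 : ℝ) ^ (n * C')⌋₊,
    Filter.Tendsto (fun n => (c n).errProb W) Filter.atTop (nhds 0)

/-- The channel with the two receivers renamed. -/
def swapChannel (W : 𝓧 → 𝓐 × 𝓑 → ℝ) : 𝓧 → 𝓑 × 𝓐 → ℝ :=
  fun x y => W x y.swap

/-- `R` is achievable with a single conference cycle started by receiver 1. -/
def AchievableStart1 [Fintype 𝓐] [Fintype 𝓑] (W : 𝓧 → 𝓐 × 𝓑 → ℝ) (C₁₂ C₂₁ R : ℝ) : Prop :=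
  Achievable W C₁₂ C₂₁ R

/-- `R` is achievable with a single conference cycle started by receiver 2. -/
def AchievableStart2 [Fintype 𝓐] [Fintype 𝓑] (W : 𝓧 → 𝓐 × 𝓑 → ℝ) (C₁₂ C₂₁ R : ℝ) : Prop :=
  Achievable (swapChannel W) C₂₁ C₁₂ R

end Codes

end CoopBC

end

/-!
The first part of the theorem is a computation. Under the erasure assignment the erasure flag is
independent of `(X, Y, Z)`, so every entropy that involves `Ŷ` is the binary entropy of the flag
plus a mixture, with weights `q` and `1 - q`, of an entropy with `Y` and one without it
(`entropy_erasureLaw_pair`). Hence `I(Y;Ŷ|Z) = q H(Y|Z)`, `I(Z;Ŷ|Y) = 0` and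
`I(X;Z,Ŷ) = I(X;Z) + q I(X;Y|Z)`, and the best choice is `α = 1` with the largest admissible `q`
(`isGreatest_eafValues`).

For achievability no estimate-and-forward code is needed: the erasures may be placed
deterministically. The receiver that starts describes its first `k ≈ qn` letters by a random bin
index, which costs about `q H(Y|Z)` bits per letter because the other receiver knows `Z`
(Slepian-Wolf). That receiver recovers the letters, decodes the message as long as
`R < I(X;Z) + q I(X;Y|Z)`, and answers with a random hash of the message; with the hash the first
receiver can decode as long as `R < I(X;Y) + C'`.

All typicality tests are thresholds for products of single-letter probability ratios. The correct
sequences pass by Chebyshev's inequality (`iidAvg_prod_lt_le`), the wrong ones fail by a change of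
measure (`sum_prod_mul_ind_le`), and the union bound over a random binning and a random codebook is
`exists_code_errProb_le`. If the fraction `q` has to be `0`, the link of the first conference
message may have capacity `0`; then there is nothing to describe and the binning error vanishes
identically. Otherwise `q` is taken slightly below `[C / H(Y|Z)]^*`, which leaves a positive margin
in every exponent (`exists_fraction`, `exists_codes_errProb_le`).
-/

namespace CoopBC

/-! ### Entropies as expectations -/

section InformationLemmas

variable {Ω Ω' α β γ δ : Type*}

lemma erasureLaw_nonneg {μ : Ω → ℝ} (hμ : ∀ ω, 0 ≤ μ ω) (Y : Ω → β) {q : ℝ}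
    (hq : q ∈ Set.Icc (0 : ℝ) 1) (ω : Ω × Option β) : 0 ≤ erasureLaw μ Y q ω := by
  obtain ⟨ω, _ | y⟩ := ω <;> refine mul_nonneg (hμ _) ?_ <;> simp only [erasure]
  · linarith [hq.2]
  · split_ifs
    exacts [hq.1, le_rfl]

variable [Fintype Ω] [Fintype Ω']

lemma law_eq_sum_mul (μ : Ω → ℝ) (A : Ω → α) (a : α) :
    law μ A a = ∑ ω, μ ω * (open Classical in if A ω = a then (1 : ℝ) else 0) := by
  simp [law]

lemma law_nonneg {μ : Ω → ℝ} (hμ : ∀ ω, 0 ≤ μ ω) (A : Ω → α) (a : α) : 0 ≤ law μ A a := by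
  unfold law
  refine Finset.sum_nonneg fun ω _ => ?_
  split_ifs
  exacts [hμ ω, le_rfl]

lemma law_pos {μ : Ω → ℝ} (hμ : ∀ ω, 0 ≤ μ ω) (A : Ω → α) {ω : Ω} (h : 0 < μ ω) :
    0 < law μ A (A ω) := by
  unfold law
  refine Finset.sum_pos' (fun ω _ => ?_) ⟨ω, Finset.mem_univ _, by simpa using h⟩
  split_ifs
  exacts [hμ ω, le_rfl]

lemma law_comp_injective (μ : Ω → ℝ) (A : Ω → α) {e : α → β} (he : Function.Injective e) (a : α) :
    law μ (fun ω => e (A ω)) (e a) = law μ A a := by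
  rw [law_eq_sum_mul, law_eq_sum_mul]
  refine Finset.sum_congr rfl fun ω _ => ?_
  by_cases h : A ω = a
  · rw [if_pos h, if_pos (congrArg e h)]
  · rw [if_neg h, if_neg (he.ne h)]

lemma law_equiv (e : Ω' ≃ Ω) (μ : Ω → ℝ) (A : Ω → α) :
    law (fun ω => μ (e ω)) (fun ω => A (e ω)) = law μ A :=
  funext fun a => e.sum_comp fun ω => open Classical in if A ω = a then μ ω else 0

variable [Fintype α]

lemma sum_law_mul (μ : Ω → ℝ) (A : Ω → α) (F : α → ℝ) :
    ∑ a, law μ A a * F a = ∑ ω, μ ω * F (A ω) := by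
  classical
  simp only [law, Finset.sum_mul]
  rw [Finset.sum_comm]
  refine Finset.sum_congr rfl fun ω _ => ?_
  simp [ite_mul]

lemma sum_law (μ : Ω → ℝ) (A : Ω → α) : ∑ a, law μ A a = ∑ ω, μ ω := by
  simpa using sum_law_mul μ A (fun _ => 1)

lemma sum_law_pair_left (μ : Ω → ℝ) (A : Ω → α) (B : Ω → β) (b : β) :
    ∑ a, law μ (fun ω => (A ω, B ω)) (a, b) = law μ B b := by
  classical
  simp only [law]
  rw [Finset.sum_comm]
  refine Finset.sum_congr rfl fun ω _ => ?_
  by_cases h : B ω = b <;> simp [h]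

lemma law_pair_le {μ : Ω → ℝ} (hμ : ∀ ω, 0 ≤ μ ω) (A : Ω → α) (B : Ω → β) (a : α) (b : β) :
    law μ (fun ω => (A ω, B ω)) (a, b) ≤ law μ B b := by
  rw [← sum_law_pair_left μ A B b]
  exact Finset.single_le_sum (f := fun a => law μ (fun ω => (A ω, B ω)) (a, b))
    (fun a _ => law_nonneg hμ _ _) (Finset.mem_univ a)

variable [Fintype β] [Fintype γ]

lemma entropy_eq_expectation (μ : Ω → ℝ) (A : Ω → α) :
    entropy μ A = -∑ ω, μ ω * Real.logb 2 (law μ A (A ω)) := by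
  rw [entropy, sum_law_mul μ A (fun a => Real.logb 2 (law μ A a))]

lemma condEntropy_eq_expectation (μ : Ω → ℝ) (A : Ω → α) (B : Ω → β) :
    condEntropy μ A B = -∑ ω, μ ω *
      Real.logb 2 (law μ (fun ω => (A ω, B ω)) (A ω, B ω) / law μ B (B ω)) := by
  rw [condEntropy, ← sum_law_mul μ (fun ω => (A ω, B ω))
    (fun u => Real.logb 2 (law μ (fun ω => (A ω, B ω)) u / law μ B u.2)), Fintype.sum_prod_type]

/-- The chain rule `H(A|B) = H(A,B) - H(B)`. -/
lemma condEntropy_eq_sub {μ : Ω → ℝ} (hμ : ∀ ω, 0 ≤ μ ω) (A : Ω → α) (B : Ω → β) :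
    condEntropy μ A B = entropy μ (fun ω => (A ω, B ω)) - entropy μ B := by
  rw [condEntropy_eq_expectation, entropy_eq_expectation, entropy_eq_expectation,
    sub_neg_eq_add, neg_add_eq_sub, ← Finset.sum_sub_distrib, ← Finset.sum_neg_distrib]
  refine Finset.sum_congr rfl fun ω _ => ?_
  rcases (hμ ω).eq_or_lt with h | h
  · simp [← h]
  · rw [Real.logb_div (law_pos hμ (fun ω => (A ω, B ω)) h).ne' (law_pos hμ B h).ne']
    ring

lemma entropy_comp_injective (μ : Ω → ℝ) (A : Ω → α) {e : α → β} (he : Function.Injective e) :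
    entropy μ (fun ω => e (A ω)) = entropy μ A := by
  rw [entropy_eq_expectation, entropy_eq_expectation]
  simp only [law_comp_injective μ A he]

lemma mutualInfo_eq_entropy {μ : Ω → ℝ} (hμ : ∀ ω, 0 ≤ μ ω) (A : Ω → α) (B : Ω → β) :
    mutualInfo μ A B = entropy μ A + entropy μ B - entropy μ (fun ω => (A ω, B ω)) := by
  rw [mutualInfo, condEntropy_eq_sub hμ]
  ring

lemma condMutualInfo_eq_entropy {μ : Ω → ℝ} (hμ : ∀ ω, 0 ≤ μ ω) (A : Ω → α) (B : Ω → β)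
    (C : Ω → γ) :
    condMutualInfo μ A B C = entropy μ (fun ω => (A ω, C ω)) + entropy μ (fun ω => (B ω, C ω))
      - entropy μ (fun ω => (A ω, B ω, C ω)) - entropy μ C := by
  rw [condMutualInfo, condEntropy_eq_sub hμ, condEntropy_eq_sub hμ]
  ring

lemma condEntropy_nonneg {μ : Ω → ℝ} (hμ : ∀ ω, 0 ≤ μ ω) (A : Ω → α) (B : Ω → β) :
    0 ≤ condEntropy μ A B := by
  rw [condEntropy_eq_expectation, ← Finset.sum_neg_distrib]
  refine Finset.sum_nonneg fun ω _ => ?_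
  rw [← mul_neg]
  refine mul_nonneg (hμ ω) (neg_nonneg.2 (Real.logb_nonpos one_lt_two ?_ ?_))
  · exact div_nonneg (law_nonneg hμ _ _) (law_nonneg hμ _ _)
  · exact div_le_one_of_le₀ (law_pair_le hμ A B _ _) (law_nonneg hμ _ _)

lemma condMutualInfo_le_condEntropy {μ : Ω → ℝ} (hμ : ∀ ω, 0 ≤ μ ω) (A : Ω → α) (B : Ω → β)
    (C : Ω → γ) : condMutualInfo μ A B C ≤ condEntropy μ B C := by
  have h := condEntropy_nonneg hμ B (fun ω => (A ω, C ω))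
  rw [condEntropy_eq_sub hμ] at h
  rw [condMutualInfo_eq_entropy hμ, condEntropy_eq_sub hμ]
  have e : entropy μ (fun ω => (B ω, A ω, C ω)) = entropy μ (fun ω => (A ω, B ω, C ω)) :=
    entropy_comp_injective μ (fun ω => (A ω, B ω, C ω))
      (e := fun u : α × β × γ => (u.2.1, u.1, u.2.2))
      (by rintro ⟨a, b, c⟩ ⟨a', b', c'⟩ h; simp_all)
  linarith

/-- Nonnegativity of `I(A;B|C)`, from `log t ≥ 1 - 1/t` applied to
`t = p(a,b,c) p(c) / (p(a,c) p(b,c))`. -/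
lemma condMutualInfo_nonneg {μ : Ω → ℝ} (hμ : ∀ ω, 0 ≤ μ ω) (A : Ω → α) (B : Ω → β)
    (C : Ω → γ) : 0 ≤ condMutualInfo μ A B C := by
  set U : Ω → α × β × γ := fun ω => (A ω, B ω, C ω) with hU
  set p := law μ U
  set pac := law μ (fun ω => (A ω, C ω))
  set pbc := law μ (fun ω => (B ω, C ω))
  set pc := law μ C
  have key : ∑ ω, μ ω * (1 - pac (A ω, C ω) * pbc (B ω, C ω) / (p (U ω) * pc (C ω)))
      ≤ Real.log 2 * condMutualInfo μ A B C := by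
    rw [condMutualInfo_eq_entropy hμ, entropy_eq_expectation, entropy_eq_expectation,
      entropy_eq_expectation, entropy_eq_expectation]
    have : ∀ a b c d : ℝ, -a + -b - -c - -d = (c + d) - (a + b) := by intros; ring
    rw [this, ← Finset.sum_add_distrib, ← Finset.sum_add_distrib, ← Finset.sum_sub_distrib,
      Finset.mul_sum]
    refine Finset.sum_le_sum fun ω _ => ?_
    rcases (hμ ω).eq_or_lt with h | h
    · simp [← h]
    · have h1 : 0 < p (U ω) := law_pos hμ U h
      have h2 : 0 < pac (A ω, C ω) := law_pos hμ (fun ω => (A ω, C ω)) h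
      have h3 : 0 < pbc (B ω, C ω) := law_pos hμ (fun ω => (B ω, C ω)) h
      have h4 : 0 < pc (C ω) := law_pos hμ C h
      have hl : Real.log 2 ≠ 0 := (Real.log_pos one_lt_two).ne'
      have e : Real.log 2 * (μ ω * Real.logb 2 (p (U ω)) + μ ω * Real.logb 2 (pc (C ω))
          - (μ ω * Real.logb 2 (pac (A ω, C ω)) + μ ω * Real.logb 2 (pbc (B ω, C ω)))) =
          μ ω * -Real.log (pac (A ω, C ω) * pbc (B ω, C ω) / (p (U ω) * pc (C ω))) := by
        rw [Real.log_div (by positivity) (by positivity), Real.log_mul h2.ne' h3.ne',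
          Real.log_mul h1.ne' h4.ne']
        simp only [Real.logb]
        field_simp
        ring
      rw [e]
      refine mul_le_mul_of_nonneg_left ?_ h.le
      have := Real.log_le_sub_one_of_pos
        (x := pac (A ω, C ω) * pbc (B ω, C ω) / (p (U ω) * pc (C ω))) (by positivity)
      linarith
  have hnn : 0 ≤ ∑ ω, μ ω *
      (1 - pac (A ω, C ω) * pbc (B ω, C ω) / (p (U ω) * pc (C ω))) := by
    simp only [mul_sub, mul_one, Finset.sum_sub_distrib]
    rw [sub_nonneg, ← sum_law_mul μ U
      (fun u => pac (u.1, u.2.2) * pbc (u.2.1, u.2.2) / (p u * pc u.2.2))]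
    calc ∑ u, p u * (pac (u.1, u.2.2) * pbc (u.2.1, u.2.2) / (p u * pc u.2.2))
        ≤ ∑ u : α × β × γ, pac (u.1, u.2.2) * pbc (u.2.1, u.2.2) / pc u.2.2 := by
          refine Finset.sum_le_sum fun u _ => ?_
          have h0 : 0 ≤ pac (u.1, u.2.2) * pbc (u.2.1, u.2.2) / pc u.2.2 :=
            div_nonneg (mul_nonneg (law_nonneg hμ _ _) (law_nonneg hμ _ _)) (law_nonneg hμ _ _)
          by_cases h : p u = 0
          · simpa [h] using h0
          · rw [mul_div_mul_comm, ← mul_assoc] at *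
            refine le_of_eq ?_
            field_simp
      _ = ∑ c, pc c := by
          rw [Fintype.sum_prod_type]
          simp only [Fintype.sum_prod_type]
          have : ∀ a, ∑ b, ∑ c, pac (a, c) * pbc (b, c) / pc c = ∑ c, pac (a, c) * pc c / pc c := by
            intro a
            rw [Finset.sum_comm]
            refine Finset.sum_congr rfl fun c _ => ?_
            rw [← Finset.sum_div, ← Finset.mul_sum, sum_law_pair_left μ B C c]
          simp only [this]
          rw [Finset.sum_comm]
          refine Finset.sum_congr rfl fun c _ => ?_
          rw [← Finset.sum_div, ← Finset.sum_mul, sum_law_pair_left μ A C c]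
          exact mul_self_div_self _
      _ = ∑ ω, μ ω := sum_law μ C
  exact nonneg_of_mul_nonneg_right (hnn.trans key) (Real.log_pos one_lt_two)

/-- The chain rule `I(A;B,C) = I(A;C) + I(A;B|C)`. -/
lemma mutualInfo_pair {μ : Ω → ℝ} (hμ : ∀ ω, 0 ≤ μ ω) (A : Ω → α) (B : Ω → β) (C : Ω → γ) :
    mutualInfo μ A (fun ω => (B ω, C ω)) = mutualInfo μ A C + condMutualInfo μ A B C := by
  rw [mutualInfo_eq_entropy hμ, mutualInfo_eq_entropy hμ, condMutualInfo_eq_entropy hμ]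
  ring

lemma mutualInfo_comp_injective {μ : Ω → ℝ} (hμ : ∀ ω, 0 ≤ μ ω) (A : Ω → α) (B : Ω → β)
    {e : β → γ} (he : Function.Injective e) :
    mutualInfo μ A (fun ω => e (B ω)) = mutualInfo μ A B := by
  rw [mutualInfo_eq_entropy hμ, mutualInfo_eq_entropy hμ, entropy_comp_injective μ B he,
    entropy_comp_injective μ (fun ω => (A ω, B ω)) (e := fun u : α × β => (u.1, e u.2))
      (by rintro ⟨a, b⟩ ⟨a', b'⟩ h; simpa [he.eq_iff] using h)]

lemma entropy_le {μ : Ω → ℝ} (hμ : ∀ ω, 0 ≤ μ ω) (A : Ω → α) :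
    entropy μ A ≤ Fintype.card α * (1 / Real.log 2) := by
  rw [entropy, ← Finset.sum_neg_distrib]
  refine (Finset.sum_le_card_nsmul _ _ (1 / Real.log 2) fun a _ => ?_).trans_eq
    (by simp [Finset.card_univ])
  have hl := Real.log_pos one_lt_two
  rw [Real.logb, le_div_iff₀ hl]
  rcases (law_nonneg hμ A a).eq_or_lt with h | h
  · simp [← h]
  · have h1 := Real.one_sub_inv_le_log_of_pos h
    have h2 := mul_le_mul_of_nonneg_left h1 h.le
    rw [mul_sub, mul_inv_cancel₀ h.ne'] at h2
    have e : -(law μ A a * (Real.log (law μ A a) / Real.log 2)) * Real.log 2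
        = -(law μ A a * Real.log (law μ A a)) := by field_simp
    rw [e]
    linarith

lemma tsRate_le {μ : Ω → ℝ} (hμ : ∀ ω, 0 ≤ μ ω) (X : Ω → α) (Y : Ω → β) (Z : Ω → γ) (C C' : ℝ) :
    tsRate μ X Y Z C C' ≤ Fintype.card α * (1 / Real.log 2) + C' := by
  refine (min_le_left _ _).trans ?_
  have h1 := entropy_le hμ X
  have h2 := condEntropy_nonneg hμ X Y
  rw [mutualInfo]
  linarith

/-- The rate depends on the joint law of the three random variables only, so the sample space may
be renamed. -/
lemma tsRate_equiv (e : Ω' ≃ Ω) (μ : Ω → ℝ) (X : Ω → α) (Y : Ω → β) (Z : Ω → γ) (C C' : ℝ) :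
    tsRate (fun ω => μ (e ω)) (fun ω => X (e ω)) (fun ω => Y (e ω)) (fun ω => Z (e ω)) C C' =
      tsRate μ X Y Z C C' := by
  have hX := law_equiv e μ X
  have hY := law_equiv e μ Y
  have hZ := law_equiv e μ Z
  have hXY := law_equiv e μ (fun ω => (X ω, Y ω))
  have hXZ := law_equiv e μ (fun ω => (X ω, Z ω))
  have hYZ := law_equiv e μ (fun ω => (Y ω, Z ω))
  have hXYZ := law_equiv e μ (fun ω => (X ω, Y ω, Z ω))
  simp only [tsRate, mutualInfo, condMutualInfo, condEntropy, entropy, hX, hY, hZ, hXY, hXZ, hYZ,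
    hXYZ]

/-! ### The erasure assignment -/

lemma sum_erasureLaw_mul (μ : Ω → ℝ) (Y : Ω → β) (q : ℝ) (F : Ω × Option β → ℝ) :
    ∑ u, erasureLaw μ Y q u * F u =
      ∑ ω, μ ω * (q * F (ω, some (Y ω)) + (1 - q) * F (ω, none)) := by
  classical
  rw [Fintype.sum_prod_type]
  refine Finset.sum_congr rfl fun ω _ => ?_
  rw [Fintype.sum_option]
  simp only [erasureLaw, erasure]
  have : ∑ y, μ ω * (if y = Y ω then q else 0) * F (ω, some y) = μ ω * q * F (ω, some (Y ω)) := by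
    rw [Finset.sum_eq_single (Y ω)]
    · simp
    · intro b _ hb; simp [hb]
    · simp
  rw [this]
  ring

lemma law_erasureLaw_fst (μ : Ω → ℝ) (Y : Ω → β) (q : ℝ) (U : Ω → δ) (u : δ) :
    law (erasureLaw μ Y q) (fun ω => U ω.1) u = law μ U u := by
  rw [law_eq_sum_mul, sum_erasureLaw_mul, law_eq_sum_mul]
  refine Finset.sum_congr rfl fun ω _ => ?_
  ring

lemma law_erasureLaw_some (μ : Ω → ℝ) (Y : Ω → β) (q : ℝ) (U : Ω → δ) (u : δ) (y : β) :
    law (erasureLaw μ Y q) (fun ω => (U ω.1, ω.2)) (u, some y) =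
      q * law μ (fun ω => (U ω, Y ω)) (u, y) := by
  rw [law_eq_sum_mul, sum_erasureLaw_mul, law_eq_sum_mul, Finset.mul_sum]
  refine Finset.sum_congr rfl fun ω _ => ?_
  have h0 : (U ω, (none : Option β)) ≠ (u, some y) := by simp
  by_cases h : (U ω, Y ω) = (u, y)
  · rw [if_pos h, if_pos (by simpa using h), if_neg h0]
    ring
  · rw [if_neg h, if_neg (by simpa using h), if_neg h0]
    ring

lemma law_erasureLaw_none (μ : Ω → ℝ) (Y : Ω → β) (q : ℝ) (U : Ω → δ) (u : δ) :
    law (erasureLaw μ Y q) (fun ω => (U ω.1, ω.2)) (u, none) = (1 - q) * law μ U u := by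
  rw [law_eq_sum_mul, sum_erasureLaw_mul, law_eq_sum_mul, Finset.mul_sum]
  refine Finset.sum_congr rfl fun ω _ => ?_
  by_cases h : U ω = u
  · rw [if_pos h, if_neg (by simp), if_pos (by simpa using h)]
    ring
  · rw [if_neg h, if_neg (by simp), if_neg (by simpa using h)]
    ring

variable [Fintype δ]

lemma entropy_erasureLaw_fst (μ : Ω → ℝ) (Y : Ω → β) (q : ℝ) (U : Ω → δ) :
    entropy (erasureLaw μ Y q) (fun ω => U ω.1) = entropy μ U := by
  simp only [entropy, law_erasureLaw_fst]

lemma sum_mul_logb_smul {f : α → ℝ} (hf : ∑ a, f a = 1) (q : ℝ) :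
    ∑ a, (q * f a) * Real.logb 2 (q * f a) =
      q * Real.logb 2 q + q * ∑ a, f a * Real.logb 2 (f a) := by
  have : ∀ a, (q * f a) * Real.logb 2 (q * f a) =
      q * Real.logb 2 q * f a + q * (f a * Real.logb 2 (f a)) := by
    intro a
    by_cases hq : q = 0
    · simp [hq]
    by_cases ha : f a = 0
    · simp [ha]
    rw [Real.logb_mul hq ha]
    ring
  simp only [this, Finset.sum_add_distrib, ← Finset.mul_sum, hf, mul_one]

/-- The erasure flag is independent of everything else: with `h` the binary entropy function,
`H(U,Ŷ) = h(q) + q H(U,Y) + (1 - q) H(U)`. -/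
lemma entropy_erasureLaw_pair {μ : Ω → ℝ} (h1 : ∑ ω, μ ω = 1) (Y : Ω → β) (q : ℝ) (U : Ω → δ) :
    entropy (erasureLaw μ Y q) (fun ω => (U ω.1, ω.2)) =
      -(q * Real.logb 2 q) - (1 - q) * Real.logb 2 (1 - q)
        + q * entropy μ (fun ω => (U ω, Y ω)) + (1 - q) * entropy μ U := by
  rw [entropy, Fintype.sum_prod_type]
  simp only [Fintype.sum_option, law_erasureLaw_none, law_erasureLaw_some]
  rw [Finset.sum_add_distrib, sum_mul_logb_smul ((sum_law μ U).trans h1),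
    ← Fintype.sum_prod_type (f := fun u : δ × β => q * law μ (fun ω => (U ω, Y ω)) u *
      Real.logb 2 (q * law μ (fun ω => (U ω, Y ω)) u)),
    sum_mul_logb_smul ((sum_law μ (fun ω => (U ω, Y ω))).trans h1), entropy, entropy]
  ring

lemma erasure_condMutualInfo {μ : Ω → ℝ} (hμ : ∀ ω, 0 ≤ μ ω) (h1 : ∑ ω, μ ω = 1) (Y : Ω → β)
    (Z : Ω → γ) {q : ℝ} (hq : q ∈ Set.Icc (0 : ℝ) 1) :
    condMutualInfo (erasureLaw μ Y q) (fun ω => Y ω.1) (fun ω => ω.2) (fun ω => Z ω.1) =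
      q * condEntropy μ Y Z := by
  have hν := erasureLaw_nonneg hμ Y hq
  have e1 : entropy (erasureLaw μ Y q) (fun ω => (ω.2, Z ω.1)) =
      entropy (erasureLaw μ Y q) (fun ω => (Z ω.1, ω.2)) :=
    entropy_comp_injective _ (fun ω : Ω × Option β => (Z ω.1, ω.2)) Prod.swap_injective
  have e2 : entropy (erasureLaw μ Y q) (fun ω => (Y ω.1, ω.2, Z ω.1)) =
      entropy (erasureLaw μ Y q) (fun ω => ((Y ω.1, Z ω.1), ω.2)) :=
    entropy_comp_injective _ (fun ω : Ω × Option β => ((Y ω.1, Z ω.1), ω.2))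
      (e := fun u : (β × γ) × Option β => (u.1.1, u.2, u.1.2))
      (by rintro ⟨⟨a, b⟩, c⟩ ⟨⟨a', b'⟩, c'⟩ h; simp_all)
  have e3 : entropy μ (fun ω => ((Y ω, Z ω), Y ω)) = entropy μ (fun ω => (Y ω, Z ω)) :=
    entropy_comp_injective _ (fun ω => (Y ω, Z ω)) (e := fun u : β × γ => (u, u.1))
      (fun u v h => (Prod.mk.inj h).1)
  have e4 : entropy μ (fun ω => (Z ω, Y ω)) = entropy μ (fun ω => (Y ω, Z ω)) :=
    entropy_comp_injective _ (fun ω => (Y ω, Z ω)) Prod.swap_injective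
  rw [condMutualInfo_eq_entropy hν, e1, e2, entropy_erasureLaw_pair h1 Y q Z,
    entropy_erasureLaw_pair h1 Y q (fun ω => (Y ω, Z ω)), entropy_erasureLaw_fst μ Y q Z,
    entropy_erasureLaw_fst μ Y q (fun ω => (Y ω, Z ω)), e3, e4, condEntropy_eq_sub hμ]
  ring

/-- `I(Z;Ŷ|Y) = 0`: the description `Ŷ` is made from `Y` alone. -/
lemma erasure_condMutualInfo_reverse {μ : Ω → ℝ} (hμ : ∀ ω, 0 ≤ μ ω) (h1 : ∑ ω, μ ω = 1)
    (Y : Ω → β) (Z : Ω → γ) {q : ℝ} (hq : q ∈ Set.Icc (0 : ℝ) 1) :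
    condMutualInfo (erasureLaw μ Y q) (fun ω => Z ω.1) (fun ω => ω.2) (fun ω => Y ω.1) = 0 := by
  have hν := erasureLaw_nonneg hμ Y hq
  have e1 : entropy (erasureLaw μ Y q) (fun ω => (ω.2, Y ω.1)) =
      entropy (erasureLaw μ Y q) (fun ω => (Y ω.1, ω.2)) :=
    entropy_comp_injective _ (fun ω : Ω × Option β => (Y ω.1, ω.2)) Prod.swap_injective
  have e2 : entropy (erasureLaw μ Y q) (fun ω => (Z ω.1, ω.2, Y ω.1)) =
      entropy (erasureLaw μ Y q) (fun ω => ((Z ω.1, Y ω.1), ω.2)) :=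
    entropy_comp_injective _ (fun ω : Ω × Option β => ((Z ω.1, Y ω.1), ω.2))
      (e := fun u : (γ × β) × Option β => (u.1.1, u.2, u.1.2))
      (by rintro ⟨⟨a, b⟩, c⟩ ⟨⟨a', b'⟩, c'⟩ h; simp_all)
  have e3 : entropy μ (fun ω => ((Z ω, Y ω), Y ω)) = entropy μ (fun ω => (Z ω, Y ω)) :=
    entropy_comp_injective _ (fun ω => (Z ω, Y ω)) (e := fun u : γ × β => (u, u.2))
      (fun u v h => (Prod.mk.inj h).1)
  have e4 : entropy μ (fun ω => (Y ω, Y ω)) = entropy μ Y :=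
    entropy_comp_injective _ Y (e := fun u : β => (u, u)) (fun u v h => (Prod.mk.inj h).1)
  rw [condMutualInfo_eq_entropy hν, e1, e2, entropy_erasureLaw_pair h1 Y q Y,
    entropy_erasureLaw_pair h1 Y q (fun ω => (Z ω, Y ω)), entropy_erasureLaw_fst μ Y q Y,
    entropy_erasureLaw_fst μ Y q (fun ω => (Z ω, Y ω)), e3, e4]
  ring

lemma erasure_mutualInfo_fst {μ : Ω → ℝ} (hμ : ∀ ω, 0 ≤ μ ω) (X : Ω → α) (Y : Ω → β) {q : ℝ}
    (hq : q ∈ Set.Icc (0 : ℝ) 1) :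
    mutualInfo (erasureLaw μ Y q) (fun ω => X ω.1) (fun ω => Y ω.1) = mutualInfo μ X Y := by
  rw [mutualInfo_eq_entropy (erasureLaw_nonneg hμ Y hq), mutualInfo_eq_entropy hμ,
    entropy_erasureLaw_fst, entropy_erasureLaw_fst,
    entropy_erasureLaw_fst μ Y q (fun ω => (X ω, Y ω))]

lemma erasure_mutualInfo_pair {μ : Ω → ℝ} (hμ : ∀ ω, 0 ≤ μ ω) (h1 : ∑ ω, μ ω = 1) (X : Ω → α)
    (Y : Ω → β) (Z : Ω → γ) {q : ℝ} (hq : q ∈ Set.Icc (0 : ℝ) 1) :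
    mutualInfo (erasureLaw μ Y q) (fun ω => X ω.1) (fun ω => (Z ω.1, ω.2)) =
      mutualInfo μ X Z + q * condMutualInfo μ X Y Z := by
  have e1 : entropy (erasureLaw μ Y q) (fun ω => (X ω.1, Z ω.1, ω.2)) =
      entropy (erasureLaw μ Y q) (fun ω => ((X ω.1, Z ω.1), ω.2)) :=
    entropy_comp_injective _ (fun ω : Ω × Option β => ((X ω.1, Z ω.1), ω.2))
      (e := fun u : (α × γ) × Option β => (u.1.1, u.1.2, u.2))
      (by rintro ⟨⟨a, b⟩, c⟩ ⟨⟨a', b'⟩, c'⟩ h; simp_all)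
  have e2 : entropy μ (fun ω => ((X ω, Z ω), Y ω)) = entropy μ (fun ω => (X ω, Y ω, Z ω)) :=
    entropy_comp_injective _ (fun ω => (X ω, Y ω, Z ω))
      (e := fun u : α × β × γ => ((u.1, u.2.2), u.2.1))
      (by rintro ⟨a, b, c⟩ ⟨a', b', c'⟩ h; simp_all)
  have e3 : entropy μ (fun ω => (Z ω, Y ω)) = entropy μ (fun ω => (Y ω, Z ω)) :=
    entropy_comp_injective _ (fun ω => (Y ω, Z ω)) Prod.swap_injective
  rw [mutualInfo_eq_entropy (erasureLaw_nonneg hμ Y hq), mutualInfo_eq_entropy hμ,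
    condMutualInfo_eq_entropy hμ, e1, entropy_erasureLaw_pair h1 Y q Z,
    entropy_erasureLaw_pair h1 Y q (fun ω => (X ω, Z ω)), entropy_erasureLaw_fst, e2, e3]
  ring

/-- The best erasure probability is `q = [C / H(Y|Z)]^*`, with `α = 1`. -/
theorem isGreatest_eafValues {μ : Ω → ℝ} (hμ : ∀ ω, 0 ≤ μ ω) (h1 : ∑ ω, μ ω = 1) (X : Ω → α)
    (Y : Ω → β) (Z : Ω → γ) {C C' : ℝ} (hC : 0 ≤ C) (hC' : 0 ≤ C') :
    IsGreatest (eafValues μ X Y Z C C') (tsRate μ X Y Z C C') := by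
  have hH := condEntropy_nonneg hμ Y Z
  have hI := condMutualInfo_nonneg hμ X Y Z
  have hIH := condMutualInfo_le_condEntropy hμ X Y Z
  constructor
  · have hq : clip (C / condEntropy μ Y Z) ∈ Set.Icc (0 : ℝ) 1 :=
      ⟨le_min (div_nonneg hC hH) zero_le_one, min_le_right _ _⟩
    refine ⟨_, hq, 1, ⟨zero_le_one, le_rfl⟩, ?_, ?_, ?_⟩
    · rw [erasure_condMutualInfo hμ h1 Y Z hq]
      refine (mul_le_mul_of_nonneg_right (min_le_left _ _) hH).trans ?_
      rw [div_mul_eq_mul_div, mul_div_assoc]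
      exact mul_le_of_le_one_right hC (div_self_le_one _)
    · rw [erasure_condMutualInfo_reverse hμ h1 Y Z hq]
      simp
    · rw [erasure_mutualInfo_fst hμ X Y hq, erasure_mutualInfo_pair hμ h1 X Y Z hq, one_mul]
      rfl
  · rintro r ⟨q, hq, a, ha, hc, -, rfl⟩
    rw [erasure_condMutualInfo hμ h1 Y Z hq] at hc
    rw [erasure_mutualInfo_fst hμ X Y hq, erasure_mutualInfo_pair hμ h1 X Y Z hq]
    refine min_le_min ?_ ?_
    · have := mul_le_of_le_one_left hC' ha.2
      linarith
    · refine add_le_add le_rfl ?_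
      rcases hH.eq_or_lt with h | h
      · -- with `H(Y|Z) = 0` the factor `I(X;Y|Z)` vanishes, whatever `q` is
        have : condMutualInfo μ X Y Z = 0 := le_antisymm (by linarith) hI
        simp [this]
      · exact mul_le_mul_of_nonneg_right (le_min ((le_div_iff₀ h).2 hc) hq.2) hI

end InformationLemmas

/-! ### Averages over independent letters -/

section IidAverage

variable {ι α : Type*} [Fintype ι] [Fintype α]

/-- The indicator of a proposition. -/
noncomputable def ind (P : Prop) : ℝ := open Classical in if P then 1 else 0

lemma ind_true {P : Prop} (h : P) : ind P = 1 := if_pos h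

lemma ind_false {P : Prop} (h : ¬P) : ind P = 0 := if_neg h

lemma ind_nonneg (P : Prop) : 0 ≤ ind P := by
  by_cases h : P
  · simp [ind_true h]
  · simp [ind_false h]

lemma ind_le_of_imp {P : Prop} {r : ℝ} (h0 : 0 ≤ r) (h : P → 1 ≤ r) : ind P ≤ r := by
  by_cases hP : P
  · simpa [ind_true hP] using h hP
  · simpa [ind_false hP] using h0

lemma ind_or_le (P Q : Prop) : ind (P ∨ Q) ≤ ind P + ind Q := by
  refine ind_le_of_imp (add_nonneg (ind_nonneg P) (ind_nonneg Q)) ?_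
  rintro (h | h)
  · linarith [ind_true h, ind_nonneg Q]
  · linarith [ind_true h, ind_nonneg P]

variable [DecidableEq ι]

/-- The expectation of `F c` when the letters `c i` are independent with law `w`. -/
def iidAvg (w : α → ℝ) (F : (ι → α) → ℝ) : ℝ :=
  ∑ c, (∏ i, w (c i)) * F c

lemma iidAvg_sum {κ : Type*} (s : Finset κ) (w : α → ℝ) (F : κ → (ι → α) → ℝ) :
    iidAvg w (fun c => ∑ k ∈ s, F k c) = ∑ k ∈ s, iidAvg w (F k) := by
  simp only [iidAvg, Finset.mul_sum]
  exact Finset.sum_comm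

lemma iidAvg_add (w : α → ℝ) (F G : (ι → α) → ℝ) :
    iidAvg w (fun c => F c + G c) = iidAvg w F + iidAvg w G := by
  simp only [iidAvg, mul_add, Finset.sum_add_distrib]

lemma iidAvg_const_mul (w : α → ℝ) (r : ℝ) (F : (ι → α) → ℝ) :
    iidAvg w (fun c => r * F c) = r * iidAvg w F := by
  simp only [iidAvg, Finset.mul_sum]
  exact Finset.sum_congr rfl fun c _ => by ring

lemma iidAvg_mono {w : α → ℝ} (hw : ∀ a, 0 ≤ w a) {F G : (ι → α) → ℝ}
    (h : ∀ c, (∀ i, 0 < w (c i)) → F c ≤ G c) : iidAvg w F ≤ iidAvg w G := by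
  refine Finset.sum_le_sum fun c _ => ?_
  by_cases hc : ∀ i, 0 < w (c i)
  · exact mul_le_mul_of_nonneg_left (h c hc) (Finset.prod_nonneg fun i _ => hw _)
  · push Not at hc
    obtain ⟨i, hi⟩ := hc
    rw [Finset.prod_eq_zero (Finset.mem_univ i) (le_antisymm hi (hw _))]
    simp

lemma iidAvg_prod (w : α → ℝ) (h : ι → α → ℝ) :
    iidAvg w (fun c => ∏ i, h i (c i)) = ∏ i, ∑ a, w a * h i a := by
  rw [Finset.prod_univ_sum, Fintype.piFinset_univ]
  simp only [iidAvg, Finset.prod_mul_distrib]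

lemma iidAvg_pair {w : α → ℝ} (hw : ∑ a, w a = 1) {i j : ι} (hij : i ≠ j) (F : α → α → ℝ) :
    iidAvg w (fun c => F (c i) (c j)) = ∑ a, ∑ b, w a * w b * F a b := by
  classical
  have hF : ∀ c : ι → α, F (c i) (c j) = ∑ a, ∑ b, F a b *
      ∏ k, ((if k = i then (if c k = a then 1 else 0) else 1) *
        (if k = j then (if c k = b then 1 else 0) else 1)) := by
    intro c
    simp only [Finset.prod_mul_distrib, Finset.prod_ite_eq', Finset.mem_univ, if_true]
    simp
  simp only [hF, iidAvg_sum, iidAvg_const_mul]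
  refine Finset.sum_congr rfl fun a _ => Finset.sum_congr rfl fun b _ => ?_
  rw [iidAvg_prod w (fun k x => (if k = i then (if x = a then 1 else 0) else 1) *
        (if k = j then (if x = b then 1 else 0) else 1)), mul_comm]
  congr 1
  have : ∀ k, ∑ x, w x * ((if k = i then (if x = a then 1 else 0) else 1) *
        (if k = j then (if x = b then 1 else 0) else 1)) =
      (if k = i then w a else 1) * (if k = j then w b else 1) := by
    intro k
    by_cases h1 : k = i
    · have h2 : k ≠ j := by rintro rfl; exact hij h1.symm
      simp [h1, hij]
    · by_cases h2 : k = j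
      · simp [h2, hij.symm]
      · simp [h1, h2, hw]
  simp only [this, Finset.prod_mul_distrib, Finset.prod_ite_eq', Finset.mem_univ, if_true]

lemma iidAvg_single {w : α → ℝ} (hw : ∑ a, w a = 1) (i : ι) (F : α → ℝ) :
    iidAvg w (fun c => F (c i)) = ∑ a, w a * F a := by
  have hF : ∀ c : ι → α, F (c i) = ∏ k, (if k = i then F (c k) else 1) := by
    intro c
    simp [Finset.prod_ite_eq']
  simp only [hF]
  rw [iidAvg_prod w (fun k x => if k = i then F x else 1),
    Finset.prod_eq_single i]
  · simp
  · intro k _ hk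
    simp [hk, hw]
  · simp

lemma iidAvg_const {w : α → ℝ} (hw : ∑ a, w a = 1) (r : ℝ) :
    iidAvg w (fun _ : ι → α => r) = r := by
  have h := iidAvg_prod w (fun (_ : ι) _ => 1)
  simp only [Finset.prod_const_one, mul_one, hw] at h
  have h2 := iidAvg_const_mul w r (fun _ : ι → α => (1 : ℝ))
  rw [h, mul_one] at h2
  simpa using h2

/-- Some outcome is at most the average. -/
lemma exists_le_of_iidAvg_le {w : α → ℝ} (hw0 : ∀ a, 0 ≤ w a) (hw : ∑ a, w a = 1)
    {F : (ι → α) → ℝ} {B : ℝ} (h : iidAvg w F ≤ B) : ∃ c, F c ≤ B := by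
  by_contra! hc
  have h1 : iidAvg w (fun _ : ι → α => B) = B := iidAvg_const hw B
  have h2 : (1 : ℝ) = ∑ c : ι → α, ∏ i, w (c i) := by
    simpa [iidAvg] using (iidAvg_const (ι := ι) hw 1).symm
  obtain ⟨c₀, -, hc₀⟩ : ∃ c ∈ (Finset.univ : Finset (ι → α)), 0 < ∏ i, w (c i) :=
    Finset.exists_lt_of_sum_lt (f := fun _ => (0 : ℝ)) (by simpa using h2 ▸ one_pos)
  have : iidAvg w (fun _ : ι → α => B) < iidAvg w F :=
    Finset.sum_lt_sum (fun c _ => mul_le_mul_of_nonneg_left (hc c).le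
      (Finset.prod_nonneg fun i _ => hw0 _)) ⟨c₀, Finset.mem_univ _,
        mul_lt_mul_of_pos_left (hc c₀) hc₀⟩
  linarith

/-- Chebyshev's inequality for a sum of independent centred random variables `g i (ω i)`. -/
lemma iidAvg_chebyshev {w : α → ℝ} (hw0 : ∀ a, 0 ≤ w a) (hw : ∑ a, w a = 1) {g : ι → α → ℝ}
    (hg : ∀ i, ∑ a, w a * g i a = 0) {V : ℝ} (hV : ∀ i, ∑ a, w a * g i a ^ 2 ≤ V) {t : ℝ}
    (ht : 0 < t) :
    iidAvg w (fun c => ind (t ≤ ∑ i, g i (c i))) ≤ Fintype.card ι * V / t ^ 2 := by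
  have h1 : iidAvg w (fun c => ind (t ≤ ∑ i, g i (c i))) ≤
      iidAvg w (fun c => (t ^ 2)⁻¹ * (∑ i, g i (c i)) ^ 2) := by
    refine iidAvg_mono hw0 fun c _ => ind_le_of_imp (by positivity) fun h => ?_
    rw [inv_mul_eq_div, one_le_div (by positivity)]
    gcongr
  refine h1.trans ?_
  rw [iidAvg_const_mul, inv_mul_eq_div]
  refine div_le_div_of_nonneg_right ?_ (by positivity)
  have h2 : iidAvg w (fun c => (∑ i, g i (c i)) ^ 2) = ∑ i, ∑ a, w a * g i a ^ 2 := by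
    simp only [sq, Finset.sum_mul_sum, iidAvg_sum]
    refine Finset.sum_congr rfl fun i _ => ?_
    rw [Finset.sum_eq_single i]
    · rw [iidAvg_single hw i (fun a => g i a * g i a)]
    · intro j _ hj
      rw [iidAvg_pair hw hj.symm (fun a b => g i a * g j b)]
      have : ∀ a b, w a * w b * (g i a * g j b) = (w a * g i a) * (w b * g j b) := by
        intros; ring
      simp only [this, ← Finset.mul_sum, hg, mul_zero, Finset.sum_const_zero]
    · simp
  rw [h2]
  refine (Finset.sum_le_card_nsmul _ _ V fun i _ => hV i).trans_eq ?_
  simp [Finset.card_univ]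

end IidAverage

/-! ### Random binning and random coding -/

section RandomCoding

variable {𝓢 𝓥 𝓤 : Type*} [Fintype 𝓢] [Fintype 𝓥] [Fintype 𝓤]

lemma sum_uniform {N : ℕ} (hN : 0 < N) : ∑ _j : Fin N, (1 / (N : ℝ)) = 1 := by
  have : (N : ℝ) ≠ 0 := by positivity
  simp [this]

/-- Random binning. If among the candidates `T v` for the value `s v` there are at most `K` wrong
ones, some map to `N` bins puts one of them into the bin of `s v` with probability at most
`K / N`. -/
lemma exists_binning {Q : 𝓥 → ℝ} (hQ0 : ∀ v, 0 ≤ Q v) (hQ : ∑ v, Q v = 1) (s : 𝓥 → 𝓢)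
    (T : 𝓥 → 𝓢 → Prop) {K : ℝ} (hK0 : 0 ≤ K)
    (hK : ∀ v, T v (s v) → ∑ s', ind (s' ≠ s v ∧ T v s') ≤ K) {N : ℕ} (hN : 0 < N) :
    ∃ f : 𝓢 → Fin N,
      ∑ v, Q v * ind (T v (s v) ∧ ∃ s', s' ≠ s v ∧ T v s' ∧ f s' = f (s v)) ≤ K / N := by
  classical
  have hw := sum_uniform hN
  have hN' : (0 : ℝ) < N := by positivity
  refine exists_le_of_iidAvg_le (w := fun _ : Fin N => 1 / (N : ℝ)) (fun _ => by positivity) hw ?_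
  have hle : ∀ (f : 𝓢 → Fin N) v,
      ind (T v (s v) ∧ ∃ s', s' ≠ s v ∧ T v s' ∧ f s' = f (s v)) ≤
        ∑ s', ind (T v (s v)) * ind (s' ≠ s v ∧ T v s') * ind (f s' = f (s v)) := by
    intro f v
    have hnn : ∀ s' ∈ Finset.univ,
        0 ≤ ind (T v (s v)) * ind (s' ≠ s v ∧ T v s') * ind (f s' = f (s v)) :=
      fun s' _ => mul_nonneg (mul_nonneg (ind_nonneg _) (ind_nonneg _)) (ind_nonneg _)
    refine ind_le_of_imp (Finset.sum_nonneg hnn) ?_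
    rintro ⟨h, s', h1, h2, h3⟩
    refine le_trans ?_ (Finset.single_le_sum hnn (Finset.mem_univ s'))
    rw [ind_true h, ind_true ⟨h1, h2⟩, ind_true h3]
    norm_num
  have hcoll : ∀ s₁ s₂ : 𝓢, s₁ ≠ s₂ →
      iidAvg (fun _ : Fin N => 1 / (N : ℝ)) (fun f : 𝓢 → Fin N => ind (f s₁ = f s₂)) = 1 / N := by
    intro s₁ s₂ h
    rw [iidAvg_pair hw h (fun a b => ind (a = b))]
    have : ∀ a : Fin N, ∑ b : Fin N, 1 / (N : ℝ) * (1 / N) * ind (a = b) = 1 / N * (1 / N) := by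
      intro a
      rw [Finset.sum_eq_single a]
      · simp [ind_true]
      · intro b _ hb
        simp [ind_false hb.symm]
      · simp
    simp only [this, ← Finset.sum_mul, hw, one_mul]
  calc _ ≤ iidAvg (fun _ : Fin N => 1 / (N : ℝ)) (fun f : 𝓢 → Fin N => ∑ v, Q v *
        ∑ s', ind (T v (s v)) * ind (s' ≠ s v ∧ T v s') * ind (f s' = f (s v))) :=
        iidAvg_mono (fun _ => by positivity) fun f _ => Finset.sum_le_sum fun v _ =>
          mul_le_mul_of_nonneg_left (hle f v) (hQ0 v)
    _ = ∑ v, Q v * ∑ s', ind (T v (s v)) * ind (s' ≠ s v ∧ T v s') * (1 / N) := by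
        simp only [iidAvg_sum, iidAvg_const_mul]
        refine Finset.sum_congr rfl fun v _ => ?_
        congr 1
        refine Finset.sum_congr rfl fun s' _ => ?_
        by_cases h : s' = s v
        · rw [ind_false (P := s' ≠ s v ∧ T v s') (by simp [h])]
          simp
        · rw [hcoll _ _ h]
    _ ≤ ∑ v, Q v * (K * (1 / N)) := by
        refine Finset.sum_le_sum fun v _ => mul_le_mul_of_nonneg_left ?_ (hQ0 v)
        rw [← Finset.sum_mul, ← Finset.mul_sum]
        refine mul_le_mul_of_nonneg_right ?_ (by positivity)
        by_cases h : T v (s v)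
        · rw [ind_true h, one_mul]
          exact hK v h
        · rw [ind_false h, zero_mul]
          exact hK0
    _ = K / N := by
        rw [← Finset.sum_mul, hQ]
        ring

/-- Random coding. Codewords `c m` are drawn with law `P`, and each message gets a random hash
`g m` of `N'` values. The event counted is that the output `v` is in `D`, that the correct codeword
fails one of the tests `T₂`, `T₃`, that a wrong one passes `T₂`, or that a wrong one with the
correct hash passes `T₃`. -/
lemma exists_codebook {P : 𝓤 → ℝ} (hP0 : ∀ x, 0 ≤ P x) (hP : ∑ x, P x = 1) {V : 𝓤 → 𝓥 → ℝ}
    (hV0 : ∀ x v, 0 ≤ V x v) (hV : ∀ x, ∑ v, V x v = 1) (D : 𝓥 → Prop) (T₂ T₃ : 𝓤 → 𝓥 → Prop)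
    {ε₂ ε₃ : ℝ} (h₂ : ∀ v, ∑ x, P x * ind (T₂ x v) ≤ ε₂) (h₃ : ∀ v, ∑ x, P x * ind (T₃ x v) ≤ ε₃)
    (M : ℕ) {N' : ℕ} (hN' : 0 < N') :
    ∃ (c : Fin M → 𝓤) (g : Fin M → Fin N'),
      ∑ m, ∑ v, V (c m) v * ind (D v ∨ ¬T₂ (c m) v ∨ ¬T₃ (c m) v ∨
        ∃ m', m' ≠ m ∧ (T₂ (c m') v ∨ g m' = g m ∧ T₃ (c m') v)) ≤
      M * (∑ x, P x * ∑ v, V x v * ind (D v ∨ ¬T₂ x v ∨ ¬T₃ x v) +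
        (M - 1) * (ε₂ + ε₃ / N')) := by
  classical
  have hN : (0 : ℝ) < N' := by positivity
  set w : 𝓤 × Fin N' → ℝ := fun u => P u.1 * (1 / N') with hwdef
  have hw0 : ∀ u, 0 ≤ w u := fun u => mul_nonneg (hP0 _) (by positivity)
  have hsum : ∀ F : 𝓤 → Fin N' → ℝ, ∑ u : 𝓤 × Fin N', w u * F u.1 u.2 =
      ∑ x, P x * ((1 / N') * ∑ j, F x j) := by
    intro F
    rw [Fintype.sum_prod_type]
    refine Finset.sum_congr rfl fun x _ => ?_
    simp only [hwdef, Finset.mul_sum]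
    exact Finset.sum_congr rfl fun j _ => by ring
  have hsum1 : ∀ F : 𝓤 → ℝ, ∑ u : 𝓤 × Fin N', w u * F u.1 = ∑ x, P x * F x := by
    intro F
    rw [hsum fun x _ => F x]
    refine Finset.sum_congr rfl fun x _ => ?_
    simp only [Finset.sum_const, Finset.card_univ, Fintype.card_fin, nsmul_eq_mul]
    field_simp
  have hw : ∑ u, w u = 1 := by simpa [hP] using hsum1 fun _ => 1
  suffices h : ∃ c : Fin M → 𝓤 × Fin N', ∑ m, ∑ v, V (c m).1 v *
      ind (D v ∨ ¬T₂ (c m).1 v ∨ ¬T₃ (c m).1 v ∨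
        ∃ m', m' ≠ m ∧ (T₂ (c m').1 v ∨ (c m').2 = (c m).2 ∧ T₃ (c m').1 v)) ≤
      M * (∑ x, P x * ∑ v, V x v * ind (D v ∨ ¬T₂ x v ∨ ¬T₃ x v) +
        (M - 1) * (ε₂ + ε₃ / N')) by
    obtain ⟨c, hc⟩ := h
    exact ⟨fun m => (c m).1, fun m => (c m).2, hc⟩
  refine exists_le_of_iidAvg_le hw0 hw ?_
  -- `G u u'` bounds the probability that a wrong pair `u'` of codeword and hash is confused with
  -- the correct pair `u`, by one of the two decoders
  set G : 𝓤 × Fin N' → 𝓤 × Fin N' → ℝ := fun u u' =>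
    ∑ v, V u.1 v * (ind (T₂ u'.1 v) + ind (u'.2 = u.2 ∧ T₃ u'.1 v)) with hG
  set A : 𝓤 → ℝ := fun x => ∑ v, V x v * ind (D v ∨ ¬T₂ x v ∨ ¬T₃ x v) with hA
  have hGavg : ∑ u, ∑ u', w u * w u' * G u u' ≤ ε₂ + ε₃ / N' := by
    have hin : ∀ u, ∑ u', w u' * G u u' ≤ ε₂ + ε₃ / N' := by
      intro u
      have e : ∑ u', w u' * G u u' = ∑ v, V u.1 v *
          (∑ u', w u' * ind (T₂ u'.1 v) + ∑ u', w u' * ind (u'.2 = u.2 ∧ T₃ u'.1 v)) := by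
        simp only [hG, ← Finset.sum_add_distrib, Finset.mul_sum]
        rw [Finset.sum_comm]
        exact Finset.sum_congr rfl fun v _ => Finset.sum_congr rfl fun u' _ => by ring
      rw [e]
      calc _ ≤ ∑ v, V u.1 v * (ε₂ + ε₃ / N') := by
            refine Finset.sum_le_sum fun v _ => mul_le_mul_of_nonneg_left ?_ (hV0 _ _)
            refine add_le_add ((hsum1 fun x => ind (T₂ x v)).trans_le (h₂ v)) ?_
            rw [hsum fun x j => ind (j = u.2 ∧ T₃ x v)]
            have : ∀ x, ∑ j : Fin N', ind (j = u.2 ∧ T₃ x v) = ind (T₃ x v) := by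
              intro x
              rw [Finset.sum_eq_single u.2]
              · simp
              · intro j _ hj
                exact ind_false fun h => hj h.1
              · simp
            simp only [this]
            have e2 : ∑ x, P x * (1 / (N' : ℝ) * ind (T₃ x v)) =
                (∑ x, P x * ind (T₃ x v)) / N' := by
              rw [Finset.sum_div]
              exact Finset.sum_congr rfl fun x _ => by ring
            rw [e2]
            exact div_le_div_of_nonneg_right (h₃ v) hN.le
        _ = ε₂ + ε₃ / N' := by rw [← Finset.sum_mul, hV, one_mul]
    calc _ = ∑ u, w u * ∑ u', w u' * G u u' := by
          simp only [Finset.mul_sum, mul_assoc]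
      _ ≤ ∑ u, w u * (ε₂ + ε₃ / N') :=
          Finset.sum_le_sum fun u _ => mul_le_mul_of_nonneg_left (hin u) (hw0 u)
      _ = ε₂ + ε₃ / N' := by rw [← Finset.sum_mul, hw, one_mul]
  calc _ ≤ iidAvg w (fun c : Fin M → 𝓤 × Fin N' => ∑ m, (A (c m).1 +
        ∑ m' ∈ Finset.univ.erase m, G (c m) (c m'))) := by
        refine iidAvg_mono hw0 fun c _ => Finset.sum_le_sum fun m _ => ?_
        simp only [hA, hG]
        rw [Finset.sum_comm, ← Finset.sum_add_distrib]
        refine Finset.sum_le_sum fun v _ => ?_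
        rw [← Finset.mul_sum, ← mul_add]
        refine mul_le_mul_of_nonneg_left ?_ (hV0 _ _)
        rw [← or_assoc, ← or_assoc, or_assoc (a := D v)]
        refine (ind_or_le _ _).trans (add_le_add le_rfl ?_)
        have hnn : ∀ m' ∈ Finset.univ.erase m,
            0 ≤ ind (T₂ (c m').1 v) + ind ((c m').2 = (c m).2 ∧ T₃ (c m').1 v) :=
          fun m' _ => add_nonneg (ind_nonneg _) (ind_nonneg _)
        refine ind_le_of_imp (Finset.sum_nonneg hnn) ?_
        rintro ⟨m', hm', h⟩
        refine le_trans ?_ (Finset.single_le_sum hnn (Finset.mem_erase.2 ⟨hm', Finset.mem_univ _⟩))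
        exact (ind_true h).ge.trans (ind_or_le _ _)
    _ = ∑ m : Fin M, (∑ x, P x * A x +
        ∑ m' ∈ Finset.univ.erase m, ∑ u, ∑ u', w u * w u' * G u u') := by
        simp only [iidAvg_sum, iidAvg_add]
        refine Finset.sum_congr rfl fun m _ => ?_
        congr 1
        · rw [iidAvg_single hw m (fun u => A u.1), hsum1]
        · refine Finset.sum_congr rfl fun m' hm' => ?_
          exact iidAvg_pair hw (Finset.ne_of_mem_erase hm').symm G
    _ ≤ ∑ m : Fin M, (∑ x, P x * A x + (M - 1) * (ε₂ + ε₃ / N')) := by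
        refine Finset.sum_le_sum fun m _ => add_le_add le_rfl ?_
        rw [Finset.sum_const, Finset.card_erase_of_mem (Finset.mem_univ _), Finset.card_univ,
          Fintype.card_fin, nsmul_eq_mul, Nat.cast_pred (Fin.pos m)]
        refine mul_le_mul_of_nonneg_left hGavg ?_
        rw [sub_nonneg]
        exact_mod_cast Fin.pos m
    _ = _ := by simp [hA, mul_add]

end RandomCoding

/-! ### Binning, decoding and answering with a hash of the message -/

section OneShot

variable {𝓧 𝓐 𝓑 𝓢 : Type*}

/-- The code made from codewords `c`, bins `f` and message hashes `g`: the first receiver sends the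
bin of its description `φ a`; the second one looks for the codeword that is compatible with `b` and
with some description in that bin, and answers with the hash of its message. -/
noncomputable def binningCode {n M N N' : ℕ} [Nonempty (Fin M)] (φ : (Fin n → 𝓐) → 𝓢)
    (T₁ : 𝓢 → (Fin n → 𝓑) → Prop) (T₂ : (Fin n → 𝓧) → 𝓢 → (Fin n → 𝓑) → Prop)
    (T₃ : (Fin n → 𝓧) → (Fin n → 𝓐) → Prop) (f : 𝓢 → Fin N) (c : Fin M → Fin n → 𝓧)
    (g : Fin M → Fin N') : Code 𝓧 𝓐 𝓑 n M N N' where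
  enc := c
  h a := f (φ a)
  h' b j := g (Classical.epsilon fun m => ∃ s, f s = j ∧ T₁ s b ∧ T₂ (c m) s b)
  dec j' a := Classical.epsilon fun m => g m = j' ∧ T₃ (c m) a
  dec' j b := Classical.epsilon fun m => ∃ s, f s = j ∧ T₁ s b ∧ T₂ (c m) s b

lemma binningCode_correct {n M N N' : ℕ} [Nonempty (Fin M)] {φ : (Fin n → 𝓐) → 𝓢}
    {T₁ : 𝓢 → (Fin n → 𝓑) → Prop} {T₂ : (Fin n → 𝓧) → 𝓢 → (Fin n → 𝓑) → Prop}
    {T₃ : (Fin n → 𝓧) → (Fin n → 𝓐) → Prop} {f : 𝓢 → Fin N} {c : Fin M → Fin n → 𝓧}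
    {g : Fin M → Fin N'} {m : Fin M} {y : Fin n → 𝓐 × 𝓑} {a : Fin n → 𝓐} {b : Fin n → 𝓑}
    (ha : a = fun i => (y i).1) (hb : b = fun i => (y i).2)
    (h₁ : T₁ (φ a) b) (h₁' : ∀ s, s ≠ φ a → T₁ s b → f s ≠ f (φ a))
    (h₂ : T₂ (c m) (φ a) b) (h₃ : T₃ (c m) a)
    (h' : ∀ m', m' ≠ m → ¬T₂ (c m') (φ a) b ∧ ¬(g m' = g m ∧ T₃ (c m') a)) :
    (binningCode φ T₁ T₂ T₃ f c g).Correct m y := by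
  have e₂ : (Classical.epsilon fun m => ∃ s, f s = f (φ a) ∧ T₁ s b ∧ T₂ (c m) s b) = m := by
    have hs := Classical.epsilon_spec
      (p := fun m => ∃ s, f s = f (φ a) ∧ T₁ s b ∧ T₂ (c m) s b) ⟨m, φ a, rfl, h₁, h₂⟩
    obtain ⟨s, hfs, hs1, hs2⟩ := hs
    by_contra hne
    have : s = φ a := by
      by_contra hsne
      exact h₁' s hsne hs1 hfs
    exact (h' _ hne).1 (this ▸ hs2)
  have e₃ : (Classical.epsilon fun m' => g m' = g m ∧ T₃ (c m') a) = m := by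
    have hs := Classical.epsilon_spec (p := fun m' => g m' = g m ∧ T₃ (c m') a) ⟨m, rfl, h₃⟩
    by_contra hne
    exact (h' _ hne).2 hs
  subst ha hb
  refine ⟨?_, e₂⟩
  simp only [binningCode]
  rw [e₂]
  exact e₃

variable [Fintype 𝓧] [Fintype 𝓐] [Fintype 𝓑]

/-- Drawing the input letters first and then the output letters amounts to drawing input-output
letters from the joint law. -/
lemma iidAvg_channel (W : 𝓧 → 𝓐 × 𝓑 → ℝ) (p : 𝓧 → ℝ) (n : ℕ)
    (F : (Fin n → 𝓧) → (Fin n → 𝓐 × 𝓑) → ℝ) :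
    ∑ x : Fin n → 𝓧, (∏ i, p (x i)) * ∑ y : Fin n → 𝓐 × 𝓑, (∏ i, W (x i) (y i)) * F x y =
      iidAvg (jointLaw W p) (fun ω : Fin n → 𝓧 × 𝓐 × 𝓑 => F (fun i => (ω i).1)
        (fun i => (ω i).2)) := by
  rw [iidAvg, ← (Equiv.arrowProdEquivProdArrow (Fin n) (fun _ => 𝓧) (fun _ => 𝓐 × 𝓑)).symm.sum_comp,
    Fintype.sum_prod_type]
  refine Finset.sum_congr rfl fun x _ => ?_
  rw [Finset.mul_sum]
  refine Finset.sum_congr rfl fun y _ => ?_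
  simp [jointLaw, Equiv.arrowProdEquivProdArrow, Finset.prod_mul_distrib, mul_assoc]

/-- The one-shot bound for the binning code, with abstract tests `T₁`, `T₂`, `T₃`. -/
theorem exists_code_errProb_le [Fintype 𝓢] {W : 𝓧 → 𝓐 × 𝓑 → ℝ}
    (hW : ∀ x, W x ∈ stdSimplex ℝ (𝓐 × 𝓑))
    {p : 𝓧 → ℝ} (hp : p ∈ stdSimplex ℝ 𝓧) {n M N N' : ℕ} (hM : 0 < M) (hN : 0 < N) (hN' : 0 < N')
    (φ : (Fin n → 𝓐) → 𝓢) (T₁ : 𝓢 → (Fin n → 𝓑) → Prop)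
    (T₂ : (Fin n → 𝓧) → 𝓢 → (Fin n → 𝓑) → Prop) (T₃ : (Fin n → 𝓧) → (Fin n → 𝓐) → Prop)
    {K ε₂ ε₃ : ℝ} (hK0 : 0 ≤ K) (hK : ∀ s b, T₁ s b → ∑ s', ind (s' ≠ s ∧ T₁ s' b) ≤ K)
    (h₂ : ∀ s b, ∑ x : Fin n → 𝓧, (∏ i, p (x i)) * ind (T₂ x s b) ≤ ε₂)
    (h₃ : ∀ a, ∑ x : Fin n → 𝓧, (∏ i, p (x i)) * ind (T₃ x a) ≤ ε₃) :
    ∃ c : Code 𝓧 𝓐 𝓑 n M N N', c.errProb W ≤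
      iidAvg (jointLaw W p) (fun ω : Fin n → 𝓧 × 𝓐 × 𝓑 =>
        ind (¬T₁ (φ fun i => (ω i).2.1) fun i => (ω i).2.2)) +
      iidAvg (jointLaw W p) (fun ω : Fin n → 𝓧 × 𝓐 × 𝓑 =>
        ind (¬T₂ (fun i => (ω i).1) (φ fun i => (ω i).2.1) fun i => (ω i).2.2)) +
      iidAvg (jointLaw W p) (fun ω : Fin n → 𝓧 × 𝓐 × 𝓑 =>
        ind (¬T₃ (fun i => (ω i).1) fun i => (ω i).2.1)) +
      K / N + (M - 1) * (ε₂ + ε₃ / N') := by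
  have : Nonempty (Fin M) := ⟨⟨0, hM⟩⟩
  set P : (Fin n → 𝓧) → ℝ := fun x => ∏ i, p (x i) with hPdef
  set V : (Fin n → 𝓧) → (Fin n → 𝓐 × 𝓑) → ℝ := fun x y => ∏ i, W (x i) (y i) with hVdef
  have hP0 : ∀ x, 0 ≤ P x := fun x => Finset.prod_nonneg fun i _ => hp.1 _
  have hP : ∑ x, P x = 1 := by
    simpa [iidAvg] using iidAvg_const (ι := Fin n) hp.2 1
  have hV0 : ∀ x y, 0 ≤ V x y := fun x y => Finset.prod_nonneg fun i _ => (hW _).1 _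
  have hV : ∀ x, ∑ y, V x y = 1 := by
    intro x
    have h := Finset.prod_univ_sum (fun _ : Fin n => (Finset.univ : Finset (𝓐 × 𝓑)))
      (fun i u => W (x i) u)
    rw [Fintype.piFinset_univ] at h
    rw [← h]
    exact Finset.prod_eq_one fun i _ => (hW _).2
  set al : (Fin n → 𝓐 × 𝓑) → Fin n → 𝓐 := fun y i => (y i).1 with hal
  set bl : (Fin n → 𝓐 × 𝓑) → Fin n → 𝓑 := fun y i => (y i).2 with hbl
  set Q : (Fin n → 𝓐 × 𝓑) → ℝ := fun y => ∑ x, P x * V x y with hQdef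
  have hQ0 : ∀ y, 0 ≤ Q y := fun y => Finset.sum_nonneg fun x _ => mul_nonneg (hP0 x) (hV0 x y)
  have hQF : ∀ F : (Fin n → 𝓐 × 𝓑) → ℝ, ∑ y, Q y * F y = ∑ x, P x * ∑ y, V x y * F y := by
    intro F
    simp only [hQdef, Finset.sum_mul, Finset.mul_sum]
    rw [Finset.sum_comm]
    exact Finset.sum_congr rfl fun x _ => Finset.sum_congr rfl fun y _ => by ring
  have hQ : ∑ y, Q y = 1 := by
    have := hQF fun _ => 1
    simpa [hV, hP] using this
  obtain ⟨f, hf⟩ := exists_binning hQ0 hQ (fun y => φ (al y)) (fun y s => T₁ s (bl y)) hK0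
    (fun y => hK _ _) hN
  set Col : (Fin n → 𝓐 × 𝓑) → Prop := fun y => T₁ (φ (al y)) (bl y) ∧
    ∃ s', s' ≠ φ (al y) ∧ T₁ s' (bl y) ∧ f s' = f (φ (al y)) with hCol
  obtain ⟨c, g, hcg⟩ := exists_codebook hP0 hP hV0 hV (fun y => ¬T₁ (φ (al y)) (bl y) ∨ Col y)
    (fun x y => T₂ x (φ (al y)) (bl y)) (fun x y => T₃ x (al y)) (fun y => h₂ _ _)
    (fun y => h₃ _) M hN'
  refine ⟨binningCode φ T₁ T₂ T₃ f c g, ?_⟩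
  have hMpos : (0 : ℝ) < M := by positivity
  have herr : (binningCode φ T₁ T₂ T₃ f c g).errProb W ≤ 1 / M * (M *
      (∑ x, P x * ∑ y, V x y * ind ((¬T₁ (φ (al y)) (bl y) ∨ Col y) ∨
        ¬T₂ x (φ (al y)) (bl y) ∨ ¬T₃ x (al y)) + (M - 1) * (ε₂ + ε₃ / N'))) := by
    refine mul_le_mul_of_nonneg_left (le_trans ?_ hcg) (by positivity)
    refine Finset.sum_le_sum fun m _ => Finset.sum_le_sum fun y _ => ?_
    split_ifs with hc
    · exact mul_nonneg (hV0 _ _) (ind_nonneg _)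
    · rw [ind_true]
      · exact (mul_one _).ge
      · by_contra hno
        simp only [hCol] at hno
        push Not at hno
        obtain ⟨⟨k1, k2⟩, k3, k4, k5⟩ := hno
        refine hc (binningCode_correct (a := al y) (b := bl y) rfl rfl k1 (k2 k1) k3 k4
          fun m' hm' => ⟨(k5 m' hm').1, fun h => (k5 m' hm').2 h.1 h.2⟩)
  refine herr.trans ?_
  rw [← mul_assoc, one_div_mul_cancel hMpos.ne', one_mul]
  refine add_le_add ?_ le_rfl
  have hsplit : ∀ x y, V x y * ind ((¬T₁ (φ (al y)) (bl y) ∨ Col y) ∨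
        ¬T₂ x (φ (al y)) (bl y) ∨ ¬T₃ x (al y)) ≤
      V x y * ind (¬T₁ (φ (al y)) (bl y)) + V x y * ind (¬T₂ x (φ (al y)) (bl y)) +
        V x y * ind (¬T₃ x (al y)) + V x y * ind (Col y) := by
    intro x y
    rw [← mul_add, ← mul_add, ← mul_add]
    refine mul_le_mul_of_nonneg_left ?_ (hV0 _ _)
    have i1 := ind_or_le (¬T₁ (φ (al y)) (bl y) ∨ Col y) (¬T₂ x (φ (al y)) (bl y) ∨ ¬T₃ x (al y))
    have i2 := ind_or_le (¬T₁ (φ (al y)) (bl y)) (Col y)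
    have i3 := ind_or_le (¬T₂ x (φ (al y)) (bl y)) (¬T₃ x (al y))
    linarith
  calc _ ≤ ∑ x, P x * ∑ y, (V x y * ind (¬T₁ (φ (al y)) (bl y)) +
        V x y * ind (¬T₂ x (φ (al y)) (bl y)) + V x y * ind (¬T₃ x (al y)) +
          V x y * ind (Col y)) :=
        Finset.sum_le_sum fun x _ => mul_le_mul_of_nonneg_left
          (Finset.sum_le_sum fun y _ => hsplit x y) (hP0 x)
    _ = ∑ x, P x * ∑ y, V x y * ind (¬T₁ (φ (al y)) (bl y)) +
        ∑ x, P x * ∑ y, V x y * ind (¬T₂ x (φ (al y)) (bl y)) +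
        ∑ x, P x * ∑ y, V x y * ind (¬T₃ x (al y)) + ∑ y, Q y * ind (Col y) := by
        simp only [hQF, Finset.sum_add_distrib, mul_add]
    _ ≤ _ := by
        refine add_le_add ?_ hf
        rw [iidAvg_channel W p n (fun _ y => ind (¬T₁ (φ (al y)) (bl y))),
          iidAvg_channel W p n (fun x y => ind (¬T₂ x (φ (al y)) (bl y))),
          iidAvg_channel W p n (fun x y => ind (¬T₃ x (al y)))]

end OneShot

open Filter Topology

/-! ### Information densities of memoryless sequences -/

section Densities

variable {Ω α β : Type*} [Fintype Ω] [Fintype α] [Fintype β]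

/-- The conditional probability `p(a|b)`, with value `0` if `p(b) = 0`. -/
noncomputable def condLaw (μ : Ω → ℝ) (A : Ω → α) (B : Ω → β) (a : α) (b : β) : ℝ :=
  law μ (fun ω => (A ω, B ω)) (a, b) / law μ B b

/-- The density `p(a,b) / (p(a) p(b))`, whose logarithm has expectation `I(A;B)`. -/
noncomputable def infoRatio (μ : Ω → ℝ) (A : Ω → α) (B : Ω → β) (a : α) (b : β) : ℝ :=
  law μ (fun ω => (A ω, B ω)) (a, b) / (law μ A a * law μ B b)

variable {μ : Ω → ℝ} (hμ : ∀ ω, 0 ≤ μ ω) (A : Ω → α) (B : Ω → β)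

include hμ

omit [Fintype α] [Fintype β] in
lemma condLaw_nonneg (a : α) (b : β) : 0 ≤ condLaw μ A B a b :=
  div_nonneg (law_nonneg hμ _ _) (law_nonneg hμ _ _)

omit [Fintype α] [Fintype β] in
lemma infoRatio_nonneg (a : α) (b : β) : 0 ≤ infoRatio μ A B a b :=
  div_nonneg (law_nonneg hμ _ _) (mul_nonneg (law_nonneg hμ _ _) (law_nonneg hμ _ _))

omit [Fintype α] [Fintype β] in
lemma condLaw_pos {ω : Ω} (h : 0 < μ ω) : 0 < condLaw μ A B (A ω) (B ω) :=
  div_pos (law_pos hμ (fun ω => (A ω, B ω)) h) (law_pos hμ B h)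

omit [Fintype α] [Fintype β] in
lemma infoRatio_pos {ω : Ω} (h : 0 < μ ω) : 0 < infoRatio μ A B (A ω) (B ω) :=
  div_pos (law_pos hμ (fun ω => (A ω, B ω)) h) (mul_pos (law_pos hμ A h) (law_pos hμ B h))

omit [Fintype β] hμ in
lemma sum_condLaw_le_one (b : β) : ∑ a, condLaw μ A B a b ≤ 1 := by
  simp only [condLaw]
  rw [← Finset.sum_div, sum_law_pair_left]
  exact div_self_le_one _

omit [Fintype β] in
lemma sum_law_mul_infoRatio_le_one (b : β) : ∑ a, law μ A a * infoRatio μ A B a b ≤ 1 := by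
  refine le_trans (Finset.sum_le_sum fun a _ => ?_) (sum_condLaw_le_one (μ := μ) A B b)
  by_cases h : law μ A a = 0
  · rw [h, zero_mul]
    exact condLaw_nonneg hμ A B a b
  · refine le_of_eq ?_
    rw [infoRatio, condLaw, mul_div_assoc', mul_div_mul_left _ _ h]

lemma sum_mul_logb_infoRatio :
    ∑ ω, μ ω * Real.logb 2 (infoRatio μ A B (A ω) (B ω)) = mutualInfo μ A B := by
  rw [mutualInfo_eq_entropy hμ, entropy_eq_expectation, entropy_eq_expectation,
    entropy_eq_expectation, sub_neg_eq_add, ← neg_add, ← Finset.sum_add_distrib, neg_add_eq_sub,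
    ← Finset.sum_sub_distrib]
  refine Finset.sum_congr rfl fun ω _ => ?_
  rcases (hμ ω).eq_or_lt with h | h
  · simp [← h]
  · have hA := law_pos hμ A h
    have hB := law_pos hμ B h
    rw [infoRatio, Real.logb_div (law_pos hμ (fun ω => (A ω, B ω)) h).ne' (mul_pos hA hB).ne',
      Real.logb_mul hA.ne' hB.ne']
    ring

end Densities

section Tails

variable {Ω : Type*} [Fintype Ω]

/-- The weak law of large numbers for `∑ log₂ rᵢ(ωᵢ)`, as a bound for the lower tail of the
product. -/
lemma iidAvg_prod_lt_le {μ : Ω → ℝ} (hμ : ∀ ω, 0 ≤ μ ω) (h1 : ∑ ω, μ ω = 1) {n : ℕ}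
    {r : Fin n → Ω → ℝ} (hr : ∀ i ω, 0 < μ ω → 0 < r i ω) {V : ℝ}
    (hV : ∀ i, ∑ ω, μ ω * (∑ ω', μ ω' * Real.logb 2 (r i ω') - Real.logb 2 (r i ω)) ^ 2 ≤ V)
    {J t : ℝ} (ht : 0 < t) (hJ : J + t ≤ ∑ i, ∑ ω, μ ω * Real.logb 2 (r i ω)) :
    iidAvg μ (fun ω => ind (¬(2 : ℝ) ^ J ≤ ∏ i, r i (ω i))) ≤ n * V / t ^ 2 := by
  have h := iidAvg_chebyshev (ι := Fin n) hμ h1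
    (g := fun i ω => ∑ ω', μ ω' * Real.logb 2 (r i ω') - Real.logb 2 (r i ω)) (fun i => by
      simp only [mul_sub, Finset.sum_sub_distrib, ← Finset.sum_mul, h1, one_mul, sub_self]) hV ht
  rw [Fintype.card_fin] at h
  refine le_trans (iidAvg_mono hμ fun ω hω => ?_) h
  refine ind_le_of_imp (ind_nonneg _) fun hlt => (ind_true ?_).ge
  rw [not_le] at hlt
  have hpos : ∀ i, 0 < r i (ω i) := fun i => hr i _ (hω i)
  have hlog : ∑ i, Real.logb 2 (r i (ω i)) < J := by
    rw [← Real.logb_prod _ _ fun i _ => (hpos i).ne',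
      Real.logb_lt_iff_lt_rpow one_lt_two (Finset.prod_pos fun i _ => hpos i)]
    exact hlt
  rw [Finset.sum_sub_distrib]
  linarith

/-- A change of measure: if `∑ w rᵢ ≤ 1` for each letter, the product of the `rᵢ` is at least `2^J`
with weight at most `2^(-J)`. -/
lemma sum_prod_mul_ind_le {w : Ω → ℝ} (hw : ∀ a, 0 ≤ w a) {n : ℕ} {r : Fin n → Ω → ℝ}
    (hr0 : ∀ i a, 0 ≤ r i a) (hr : ∀ i, ∑ a, w a * r i a ≤ 1) (J : ℝ) :
    ∑ x : Fin n → Ω, (∏ i, w (x i)) * ind ((2 : ℝ) ^ J ≤ ∏ i, r i (x i)) ≤ 2 ^ (-J) := by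
  have hJ : (0 : ℝ) < 2 ^ J := by positivity
  calc _ ≤ iidAvg w (fun x : Fin n → Ω => 2 ^ (-J) * ∏ i, r i (x i)) := by
        refine iidAvg_mono hw fun x _ => ?_
        have h0 : 0 ≤ ∏ i, r i (x i) := Finset.prod_nonneg fun i _ => hr0 i _
        refine ind_le_of_imp (by positivity) fun h => ?_
        rw [Real.rpow_neg zero_le_two, inv_mul_eq_div, one_le_div hJ]
        exact h
    _ = 2 ^ (-J) * ∏ i, ∑ a, w a * r i a := by rw [iidAvg_const_mul, iidAvg_prod]
    _ ≤ 2 ^ (-J) := mul_le_of_le_one_right (by positivity)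
        (Finset.prod_le_one (fun i _ => Finset.sum_nonneg fun a _ => mul_nonneg (hw a) (hr0 i a))
          fun i _ => hr i)

lemma sum_time_sharing (F : Bool → ℝ) {n k : ℕ} (hk : k ≤ n) :
    ∑ i : Fin n, F (decide (i.val < k)) = k * F true + (n - k) * F false := by
  obtain ⟨l, rfl⟩ := Nat.exists_eq_add_of_le hk
  rw [Fin.sum_univ_add]
  simp

end Tails

/-! ### Achievability -/

section Achievability

variable {𝓧 𝓐 𝓑 : Type*} [Fintype 𝓧] [Fintype 𝓐] [Fintype 𝓑]

/-- One letter of the time-sharing description: the letter itself, or an erasure. -/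
def reveal {α : Type*} (b : Bool) (y : α) : Option α := if b then some y else none

/-- The random variable `(Ŷ, Z)` when `Ŷ` is the revealed or the erased letter `Y`. -/
def revealPair (b : Bool) (ω : 𝓧 × 𝓐 × 𝓑) : Option 𝓐 × 𝓑 := (reveal b ω.2.1, ω.2.2)

lemma jointLaw_nonneg {W : 𝓧 → 𝓐 × 𝓑 → ℝ} (hW : ∀ x, W x ∈ stdSimplex ℝ (𝓐 × 𝓑)) {p : 𝓧 → ℝ}
    (hp : p ∈ stdSimplex ℝ 𝓧) (ω : 𝓧 × 𝓐 × 𝓑) : 0 ≤ jointLaw W p ω :=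
  mul_nonneg (hp.1 _) ((hW _).1 _)

lemma sum_jointLaw {W : 𝓧 → 𝓐 × 𝓑 → ℝ} (hW : ∀ x, W x ∈ stdSimplex ℝ (𝓐 × 𝓑)) {p : 𝓧 → ℝ}
    (hp : p ∈ stdSimplex ℝ 𝓧) : ∑ ω, jointLaw W p ω = 1 := by
  rw [Fintype.sum_prod_type]
  simp only [jointLaw, ← Finset.mul_sum, (hW _).2, mul_one, hp.2]

lemma law_jointLaw_fst {W : 𝓧 → 𝓐 × 𝓑 → ℝ} (hW : ∀ x, W x ∈ stdSimplex ℝ (𝓐 × 𝓑)) (p : 𝓧 → ℝ)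
    (x : 𝓧) : law (jointLaw W p) (fun ω => ω.1) x = p x := by
  rw [law, Fintype.sum_prod_type, Finset.sum_eq_single x]
  · simp only [if_true, jointLaw, ← Finset.mul_sum, (hW _).2, mul_one]
  · intro x' _ hx'
    simp [hx']
  · simp

lemma mutualInfo_revealPair {μ : 𝓧 × 𝓐 × 𝓑 → ℝ} (hμ : ∀ ω, 0 ≤ μ ω) (b : Bool) :
    mutualInfo μ (fun ω => ω.1) (revealPair b) = mutualInfo μ (fun ω => ω.1) (fun ω => ω.2.2) +
      if b then condMutualInfo μ (fun ω => ω.1) (fun ω => ω.2.1) (fun ω => ω.2.2) else 0 := by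
  cases b
  · have h := mutualInfo_comp_injective hμ (fun ω => ω.1) (fun ω => ω.2.2)
      (e := fun z : 𝓑 => ((none : Option 𝓐), z)) (fun u v h => (Prod.mk.inj h).2)
    rw [if_neg Bool.false_ne_true, add_zero]
    exact h
  · have h := mutualInfo_comp_injective hμ (fun ω => ω.1) (fun ω => (ω.2.1, ω.2.2))
      (e := fun u : 𝓐 × 𝓑 => (some u.1, u.2)) (by rintro ⟨a, b⟩ ⟨a', b'⟩ h; simpa using h)
    rw [if_pos rfl, ← mutualInfo_pair hμ]
    exact h

lemma condEntropy_reveal {μ : 𝓧 × 𝓐 × 𝓑 → ℝ} (hμ : ∀ ω, 0 ≤ μ ω) (b : Bool) :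
    condEntropy μ (fun ω => reveal b ω.2.1) (fun ω => ω.2.2) =
      if b then condEntropy μ (fun ω => ω.2.1) (fun ω => ω.2.2) else 0 := by
  rw [condEntropy_eq_sub hμ]
  cases b
  · have h := entropy_comp_injective μ (fun ω => ω.2.2)
      (e := fun z : 𝓑 => ((none : Option 𝓐), z)) (fun u v h => (Prod.mk.inj h).2)
    simp only [reveal, Bool.false_eq_true, if_false]
    rw [h, sub_self]
  · have h := entropy_comp_injective μ (fun ω => (ω.2.1, ω.2.2))
      (e := fun u : 𝓐 × 𝓑 => (some u.1, u.2)) (by rintro ⟨a, b⟩ ⟨a', b'⟩ h; simpa using h)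
    simp only [reveal, if_true]
    rw [h, condEntropy_eq_sub hμ]

/-- Time sharing with abstract test `T₁` for the description: the first receiver describes its
first `k` letters. The tests of the decoders are thresholds for the information densities, placed
`n * δ` below their expectations. -/
lemma exists_timeSharing_code {W : 𝓧 → 𝓐 × 𝓑 → ℝ} (hW : ∀ x, W x ∈ stdSimplex ℝ (𝓐 × 𝓑))
    {p : 𝓧 → ℝ} (hp : p ∈ stdSimplex ℝ 𝓧) :
    ∃ V : ℝ, ∀ {δ : ℝ} {n k M N N' : ℕ}, 0 < δ → 0 < n → k ≤ n → 0 < M → 0 < N → 0 < N' →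
      ∀ (T₁ : (Fin n → Option 𝓐) → (Fin n → 𝓑) → Prop) (K : ℝ), 0 ≤ K →
      (∀ s b, T₁ s b → ∑ s', ind (s' ≠ s ∧ T₁ s' b) ≤ K) →
      ∃ c : Code 𝓧 𝓐 𝓑 n M N N', c.errProb W ≤
        iidAvg (jointLaw W p) (fun ω : Fin n → 𝓧 × 𝓐 × 𝓑 =>
          ind (¬T₁ (fun i => reveal (decide (i.val < k)) (ω i).2.1) fun i => (ω i).2.2)) +
        n * V / (n * δ) ^ 2 + n * V / (n * δ) ^ 2 + K / N + (M - 1) *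
        (2 ^ (-(n * mutualInfo (jointLaw W p) (fun ω => ω.1) (fun ω => ω.2.2) +
            k * condMutualInfo (jointLaw W p) (fun ω => ω.1) (fun ω => ω.2.1) (fun ω => ω.2.2) -
            n * δ)) +
          2 ^ (-(n * mutualInfo (jointLaw W p) (fun ω => ω.1) (fun ω => ω.2.1) - n * δ)) / N') := by
  have hμ := jointLaw_nonneg hW hp
  have h1 := sum_jointLaw hW hp
  set μ := jointLaw W p with hμdef
  set X : 𝓧 × 𝓐 × 𝓑 → 𝓧 := fun ω => ω.1 with hX
  set Y : 𝓧 × 𝓐 × 𝓑 → 𝓐 := fun ω => ω.2.1 with hY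
  set Z : 𝓧 × 𝓐 × 𝓑 → 𝓑 := fun ω => ω.2.2 with hZ
  -- the variance of the logarithm of a density
  set var : (𝓧 × 𝓐 × 𝓑 → ℝ) → ℝ := fun r =>
    ∑ ω, μ ω * (∑ ω', μ ω' * Real.logb 2 (r ω') - Real.logb 2 (r ω)) ^ 2 with hvar
  have hvar0 : ∀ r, 0 ≤ var r := fun r =>
    Finset.sum_nonneg fun ω _ => mul_nonneg (hμ ω) (sq_nonneg _)
  set d₂ : Bool → 𝓧 × 𝓐 × 𝓑 → ℝ := fun b ω =>
    infoRatio μ X (revealPair b) (X ω) (revealPair b ω) with hd₂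
  set d₃ : 𝓧 × 𝓐 × 𝓑 → ℝ := fun ω => infoRatio μ X Y (X ω) (Y ω) with hd₃
  refine ⟨var (d₂ true) + var (d₂ false) + var d₃, ?_⟩
  intro δ n k M N N' hδ hn hk hM hN hN' T₁ K hK0 hK
  have hnδ : 0 < n * δ := by positivity
  set J₂ : ℝ := n * mutualInfo μ X Z + k * condMutualInfo μ X Y Z - n * δ with hJ₂
  set J₃ : ℝ := n * mutualInfo μ X Y - n * δ with hJ₃
  have hpw : ∀ x, p x = law μ X x := fun x => (law_jointLaw_fst hW p x).symm
  obtain ⟨c, hc⟩ := exists_code_errProb_le hW hp hM hN hN'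
    (fun (a : Fin n → 𝓐) i => reveal (decide (i.val < k)) (a i)) T₁
    (fun x s b => (2 : ℝ) ^ J₂ ≤ ∏ i : Fin n,
      infoRatio μ X (revealPair (decide (i.val < k))) (x i) (s i, b i))
    (fun x a => (2 : ℝ) ^ J₃ ≤ ∏ i : Fin n, infoRatio μ X Y (x i) (a i)) hK0 hK
    (ε₂ := 2 ^ (-J₂)) (ε₃ := 2 ^ (-J₃))
    (fun s b => sum_prod_mul_ind_le hp.1 (fun i x => infoRatio_nonneg hμ _ _ _ _)
      (r := fun i x => infoRatio μ X (revealPair (decide (i.val < k))) x (s i, b i))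
      (fun i => by simpa only [hpw] using sum_law_mul_infoRatio_le_one hμ X _ _) J₂)
    (fun a => sum_prod_mul_ind_le hp.1 (fun i x => infoRatio_nonneg hμ _ _ _ _)
      (r := fun i x => infoRatio μ X Y x (a i))
      (fun i => by simpa only [hpw] using sum_law_mul_infoRatio_le_one hμ X _ _) J₃)
  refine ⟨c, hc.trans ?_⟩
  refine add_le_add (add_le_add (add_le_add (add_le_add le_rfl ?_) ?_) le_rfl) le_rfl
  · refine iidAvg_prod_lt_le hμ h1 (r := fun i => d₂ (decide (i.val < k)))
      (fun i ω h => infoRatio_pos hμ _ _ h) (fun i => ?_) hnδ ?_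
    · change var (d₂ (decide (i.val < k))) ≤ _
      cases decide (i.val < k) <;>
        linarith [hvar0 (d₂ true), hvar0 (d₂ false), hvar0 d₃]
    · have e : ∀ b, ∑ ω, μ ω * Real.logb 2 (d₂ b ω) = mutualInfo μ X (revealPair b) :=
        fun b => sum_mul_logb_infoRatio hμ X (revealPair b)
      simp only [e]
      rw [sum_time_sharing (fun b => mutualInfo μ X (revealPair b)) hk, mutualInfo_revealPair hμ,
        mutualInfo_revealPair hμ]
      simp only [if_true, Bool.false_eq_true, if_false]
      refine le_of_eq ?_
      simp only [hJ₂, hX, hY, hZ]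
      ring
  · refine iidAvg_prod_lt_le hμ h1 (r := fun _ => d₃)
      (fun i ω h => infoRatio_pos hμ _ _ h) (fun i => ?_) hnδ ?_
    · change var d₃ ≤ _
      linarith [hvar0 (d₂ true), hvar0 (d₂ false), hvar0 d₃]
    · rw [sum_mul_logb_infoRatio hμ X Y]
      simp [hJ₃]

/-- The test that the description is likely given the side information: at most `2^(kH + nδ)`
descriptions pass it, where `H = H(Y|Z)`. -/
lemma exists_description_test {μ : 𝓧 × 𝓐 × 𝓑 → ℝ} (hμ : ∀ ω, 0 ≤ μ ω) (h1 : ∑ ω, μ ω = 1) :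
    ∃ V : ℝ, ∀ {δ : ℝ} {n k : ℕ}, 0 < δ → 0 < n → k ≤ n →
      ∃ T₁ : (Fin n → Option 𝓐) → (Fin n → 𝓑) → Prop,
        (∀ s b, T₁ s b → ∑ s', ind (s' ≠ s ∧ T₁ s' b) ≤
          2 ^ (k * condEntropy μ (fun ω => ω.2.1) (fun ω => ω.2.2) + n * δ)) ∧
        iidAvg μ (fun ω : Fin n → 𝓧 × 𝓐 × 𝓑 =>
          ind (¬T₁ (fun i => reveal (decide (i.val < k)) (ω i).2.1) fun i => (ω i).2.2)) ≤
          n * V / (n * δ) ^ 2 := by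
  set H := condEntropy μ (fun ω => ω.2.1) (fun ω => ω.2.2) with hH
  set d₁ : Bool → Option 𝓐 → 𝓑 → ℝ := fun b =>
    condLaw μ (fun ω => reveal b ω.2.1) (fun ω => ω.2.2) with hd₁
  set var : (𝓧 × 𝓐 × 𝓑 → ℝ) → ℝ := fun r =>
    ∑ ω, μ ω * (∑ ω', μ ω' * Real.logb 2 (r ω') - Real.logb 2 (r ω)) ^ 2 with hvar
  have hvar0 : ∀ r, 0 ≤ var r := fun r =>
    Finset.sum_nonneg fun ω _ => mul_nonneg (hμ ω) (sq_nonneg _)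
  refine ⟨var (fun ω => d₁ true (reveal true ω.2.1) ω.2.2) +
    var (fun ω => d₁ false (reveal false ω.2.1) ω.2.2), ?_⟩
  intro δ n k hδ hn hk
  refine ⟨fun s b => (2 : ℝ) ^ (-(k * H + n * δ)) ≤ ∏ i : Fin n,
    d₁ (decide (i.val < k)) (s i) (b i), ?_, ?_⟩
  · intro s b _
    have h := sum_prod_mul_ind_le (w := fun _ : Option 𝓐 => (1 : ℝ)) (fun _ => zero_le_one)
      (r := fun (i : Fin n) s => d₁ (decide (i.val < k)) s (b i))
      (fun i s => condLaw_nonneg hμ _ _ _ _)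
      (fun i => by simpa only [one_mul] using sum_condLaw_le_one _ _ _) (-(k * H + n * δ))
    rw [neg_neg] at h
    refine le_trans (Finset.sum_le_sum fun s' _ => ?_) h
    rw [Finset.prod_const_one, one_mul]
    exact ind_le_of_imp (ind_nonneg _) fun h => (ind_true h.2).ge
  · refine iidAvg_prod_lt_le hμ h1
      (r := fun i ω => d₁ (decide (i.val < k)) (reveal (decide (i.val < k)) ω.2.1) ω.2.2)
      (fun i ω h => condLaw_pos hμ (fun ω => reveal (decide (i.val < k)) ω.2.1) (fun ω => ω.2.2) h)
      (fun i => ?_) (by positivity) ?_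
    · change var (fun ω => d₁ (decide (i.val < k)) (reveal (decide (i.val < k)) ω.2.1) ω.2.2) ≤ _
      cases decide (i.val < k) <;>
        linarith [hvar0 (fun ω => d₁ true (reveal true ω.2.1) ω.2.2),
          hvar0 (fun ω => d₁ false (reveal false ω.2.1) ω.2.2)]
    · have e : ∀ b, ∑ ω, μ ω * Real.logb 2 (d₁ b (reveal b ω.2.1) ω.2.2) =
          -condEntropy μ (fun ω => reveal b ω.2.1) (fun ω => ω.2.2) := by
        intro b
        rw [condEntropy_eq_expectation, neg_neg]
        rfl
      simp only [e]
      rw [sum_time_sharing (fun b => -condEntropy μ (fun ω => reveal b ω.2.1) (fun ω => ω.2.2)) hk,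
        condEntropy_reveal hμ, condEntropy_reveal hμ]
      simp only [if_true, Bool.false_eq_true, if_false]
      refine le_of_eq ?_
      rw [← hH]
      ring

/-- A time-sharing fraction `q` slightly below `[C / H(Y|Z)]^*` leaves room in both rate
constraints; if `q` has to be `0`, no description is sent at all. -/
lemma exists_fraction {I H D C R : ℝ} (hH : 0 ≤ H) (hC : 0 ≤ C)
    (hR : R < I + clip (C / H) * D) :
    ∃ q ∈ Set.Icc (0 : ℝ) 1, R < I + q * D ∧ (q = 0 ∨ q * H < C) := by
  have hq1 : clip (C / H) ≤ 1 := min_le_right _ _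
  have hq0 : 0 ≤ clip (C / H) := le_min (div_nonneg hC hH) zero_le_one
  rcases hq0.eq_or_lt with h | h
  · exact ⟨0, ⟨le_rfl, zero_le_one⟩, by rwa [h], Or.inl rfl⟩
  · have hcont : Tendsto (fun q : ℝ => I + q * D) (𝓝[<] clip (C / H))
        (𝓝 (I + clip (C / H) * D)) := by
      refine Tendsto.mono_left ?_ nhdsWithin_le_nhds
      exact (continuous_const.add (continuous_id.mul continuous_const)).tendsto _
    obtain ⟨q, hqR, hq⟩ := ((hcont.eventually (lt_mem_nhds hR)).and
      (Ioo_mem_nhdsLT h)).exists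
    refine ⟨q, ⟨hq.1.le, hq.2.le.trans hq1⟩, hqR, Or.inr ?_⟩
    have hHne : 0 < H := by
      refine lt_of_le_of_ne hH fun h0 => ?_
      rw [← h0, div_zero, clip, min_eq_left zero_le_one] at h
      exact lt_irrefl _ h
    exact (lt_div_iff₀ hHne).1 (hq.2.trans_le (min_le_left _ _))

lemma rpow_div_two_le_floor {t : ℝ} (ht : 0 ≤ t) : (2 : ℝ) ^ t / 2 ≤ ⌊(2 : ℝ) ^ t⌋₊ := by
  have h1 : (1 : ℝ) ≤ 2 ^ t := Real.one_le_rpow one_le_two ht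
  have h2 := Nat.lt_floor_add_one ((2 : ℝ) ^ t)
  have h3 : (1 : ℝ) ≤ ⌊(2 : ℝ) ^ t⌋₊ := by exact_mod_cast (Nat.one_le_floor_iff _).2 h1
  linarith

omit [Fintype 𝓧] in
lemma errProb_nonneg {W : 𝓧 → 𝓐 × 𝓑 → ℝ} (hW : ∀ x, W x ∈ stdSimplex ℝ (𝓐 × 𝓑))
    {n M N N' : ℕ} (c : Code 𝓧 𝓐 𝓑 n M N N') : 0 ≤ c.errProb W := by
  refine mul_nonneg (by positivity) (Finset.sum_nonneg fun m _ => Finset.sum_nonneg fun y _ => ?_)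
  split_ifs
  exacts [le_rfl, Finset.prod_nonneg fun i _ => (hW _).1 _]

/-- The error exponents leave a margin `δ` everywhere, so that all error terms together are
`O(1/n) + O(2^(-nδ))`. -/
theorem exists_codes_errProb_le [Nonempty 𝓧] {W : 𝓧 → 𝓐 × 𝓑 → ℝ}
    (hW : ∀ x, W x ∈ stdSimplex ℝ (𝓐 × 𝓑)) {p : 𝓧 → ℝ} (hp : p ∈ stdSimplex ℝ 𝓧) {C C' R : ℝ}
    (hC : 0 ≤ C) (hC' : 0 ≤ C') (hR : R < R12 W C C' p) :
    ∃ V D δ : ℝ, 0 < δ ∧ ∀ n : ℕ, 0 < n →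
      ∃ c : Code 𝓧 𝓐 𝓑 n ⌈(2 : ℝ) ^ (n * R)⌉₊ ⌊(2 : ℝ) ^ (n * C)⌋₊ ⌊(2 : ℝ) ^ (n * C')⌋₊,
        c.errProb W ≤ V / n + D * (2 ^ (-δ)) ^ n := by
  have hμ := jointLaw_nonneg hW hp
  have h1 := sum_jointLaw hW hp
  obtain ⟨V₂, hcode⟩ := exists_timeSharing_code hW hp
  obtain ⟨V₁, htest⟩ := exists_description_test hμ h1
  rw [R12, tsRate, lt_min_iff] at hR
  obtain ⟨hR₃, hR₂⟩ := hR
  set μ := jointLaw W p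
  have hH := condEntropy_nonneg hμ (fun ω : 𝓧 × 𝓐 × 𝓑 => ω.2.1) (fun ω => ω.2.2)
  have hD := condMutualInfo_nonneg hμ (fun ω : 𝓧 × 𝓐 × 𝓑 => ω.1) (fun ω => ω.2.1) (fun ω => ω.2.2)
  set IY := mutualInfo μ (fun ω => ω.1) (fun ω => ω.2.1)
  set IZ := mutualInfo μ (fun ω => ω.1) (fun ω => ω.2.2)
  set D := condMutualInfo μ (fun ω => ω.1) (fun ω => ω.2.1) (fun ω => ω.2.2)
  set H := condEntropy μ (fun ω => ω.2.1) (fun ω => ω.2.2)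
  obtain ⟨q, hq, hqR, hqC⟩ := exists_fraction hH hC hR₂
  obtain ⟨δ, hδ, hδ₃, hδ₂, hδ₁⟩ : ∃ δ : ℝ, 0 < δ ∧ 2 * δ ≤ IY + C' - R ∧
      2 * δ ≤ IZ + q * D - R ∧ (q = 0 ∨ 2 * δ ≤ C - q * H) := by
    rcases hqC with h | h
    · refine ⟨min (IY + C' - R) (IZ + q * D - R) / 2, ?_, ?_, ?_, Or.inl h⟩
      · have : 0 < min (IY + C' - R) (IZ + q * D - R) := lt_min (by linarith) (by linarith)
        linarith
      · linarith [min_le_left (IY + C' - R) (IZ + q * D - R)]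
      · linarith [min_le_right (IY + C' - R) (IZ + q * D - R)]
    · set e := min (min (IY + C' - R) (IZ + q * D - R)) (C - q * H) with he
      have h1 : e ≤ min (IY + C' - R) (IZ + q * D - R) := min_le_left _ _
      have h2 : e ≤ C - q * H := min_le_right _ _
      have h3 : 0 < e := lt_min (lt_min (by linarith) (by linarith)) (by linarith)
      exact ⟨e / 2, by linarith, by linarith [h1.trans (min_le_left _ _)],
        by linarith [h1.trans (min_le_right _ _)], Or.inr (by linarith)⟩
  refine ⟨(|V₁| + V₂ + V₂) / δ ^ 2, 4 + 2 ^ D, δ, hδ, fun n hn => ?_⟩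
  have hn' : (0 : ℝ) < n := by exact_mod_cast hn
  set k := ⌊q * n⌋₊ with hkdef
  have hkq : (k : ℝ) ≤ q * n := Nat.floor_le (mul_nonneg hq.1 hn'.le)
  have hkq' : q * n < k + 1 := Nat.lt_floor_add_one _
  have hk : k ≤ n := by
    have : (k : ℝ) ≤ n := hkq.trans (mul_le_of_le_one_left hn'.le hq.2)
    exact_mod_cast this
  have hnC : 0 ≤ n * C := by positivity
  have hnC' : 0 ≤ n * C' := by positivity
  have hNr := rpow_div_two_le_floor hnC
  have hNr' := rpow_div_two_le_floor hnC'
  set M := ⌈(2 : ℝ) ^ (n * R)⌉₊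
  set N := ⌊(2 : ℝ) ^ (n * C)⌋₊
  set N' := ⌊(2 : ℝ) ^ (n * C')⌋₊
  have hM : 0 < M := Nat.ceil_pos.2 (by positivity)
  have hN0 : (0 : ℝ) < N := lt_of_lt_of_le (by positivity) hNr
  have hN0' : (0 : ℝ) < N' := lt_of_lt_of_le (by positivity) hNr'
  have hN : 0 < N := by exact_mod_cast hN0
  have hN' : 0 < N' := by exact_mod_cast hN0'
  have hM1 : (M : ℝ) - 1 ≤ 2 ^ (n * R) := by
    have := Nat.ceil_lt_add_one (a := (2 : ℝ) ^ (n * R)) (by positivity)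
    linarith
  have hpow : ((2 : ℝ) ^ (-δ)) ^ n = 2 ^ (-(n * δ)) := by
    rw [← Real.rpow_mul_natCast zero_le_two]
    congr 1
    ring
  -- the description of the first `k` letters; it is known beforehand if `q = 0`
  obtain ⟨T₁, K, hK0, hK, hT₁, hKN⟩ : ∃ (T₁ : (Fin n → Option 𝓐) → (Fin n → 𝓑) → Prop) (K : ℝ),
      0 ≤ K ∧ (∀ s b, T₁ s b → ∑ s', ind (s' ≠ s ∧ T₁ s' b) ≤ K) ∧
      iidAvg μ (fun ω : Fin n → 𝓧 × 𝓐 × 𝓑 =>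
        ind (¬T₁ (fun i => reveal (decide (i.val < k)) (ω i).2.1) fun i => (ω i).2.2)) ≤
          n * |V₁| / (n * δ) ^ 2 ∧ K / N ≤ 2 * 2 ^ (-(n * δ)) := by
    rcases hδ₁ with h | h
    · have hk0 : k = 0 := by simp [hkdef, h]
      refine ⟨fun s _ => s = fun _ => none, 0, le_rfl, ?_, ?_, ?_⟩
      · rintro s b rfl
        exact (Finset.sum_eq_zero fun s' _ => ind_false fun h => h.1 h.2).le
      · have : ∀ ω : Fin n → 𝓧 × 𝓐 × 𝓑,
            ind (¬(fun i : Fin n => reveal (decide (i.val < k)) (ω i).2.1) = fun _ => none) = 0 :=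
          fun ω => ind_false (by simp [hk0, reveal])
        simp only [this]
        rw [iidAvg_const h1]
        positivity
      · rw [zero_div]
        positivity
    · obtain ⟨T₁, hT, hT'⟩ := htest hδ hn hk
      refine ⟨T₁, 2 ^ (k * H + n * δ), by positivity, hT, hT'.trans ?_, ?_⟩
      · gcongr
        exact le_abs_self _
      · rw [div_le_iff₀ hN0]
        have e : (2 : ℝ) ^ (k * H + n * δ) ≤ 2 ^ (-(n * δ)) * 2 ^ (n * C) := by
          rw [← Real.rpow_add two_pos]
          refine Real.rpow_le_rpow_of_exponent_le one_le_two ?_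
          have a1 : k * H ≤ q * n * H := mul_le_mul_of_nonneg_right hkq hH
          have a2 : n * (2 * δ) ≤ n * (C - q * H) := mul_le_mul_of_nonneg_left h hn'.le
          linarith
        have a3 := mul_le_mul_of_nonneg_left hNr
          (by positivity : (0 : ℝ) ≤ 2 * 2 ^ (-(n * δ)))
        linarith
  obtain ⟨c, hc⟩ := hcode hδ hn hk hM hN hN' T₁ K hK0 hK
  refine ⟨c, hc.trans ?_⟩
  rw [hpow]
  have e₂ : ((M : ℝ) - 1) * 2 ^ (-(n * IZ + k * D - n * δ)) ≤ 2 ^ D * 2 ^ (-(n * δ)) := by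
    refine (mul_le_mul_of_nonneg_right hM1 (by positivity)).trans ?_
    rw [← Real.rpow_add two_pos, ← Real.rpow_add two_pos]
    refine Real.rpow_le_rpow_of_exponent_le one_le_two ?_
    have a1 : q * n * D ≤ (k + 1) * D := mul_le_mul_of_nonneg_right hkq'.le hD
    have a2 : n * (2 * δ) ≤ n * (IZ + q * D - R) := mul_le_mul_of_nonneg_left hδ₂ hn'.le
    linarith
  have e₃ : ((M : ℝ) - 1) * (2 ^ (-(n * IY - n * δ)) / N') ≤ 2 * 2 ^ (-(n * δ)) := by
    refine (mul_le_mul_of_nonneg_right hM1 (by positivity)).trans ?_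
    rw [mul_div_assoc', div_le_iff₀ hN0', ← Real.rpow_add two_pos]
    have e : (2 : ℝ) ^ (n * R + -(n * IY - n * δ)) ≤ 2 ^ (-(n * δ)) * 2 ^ (n * C') := by
      rw [← Real.rpow_add two_pos]
      refine Real.rpow_le_rpow_of_exponent_le one_le_two ?_
      have a2 : n * (2 * δ) ≤ n * (IY + C' - R) := mul_le_mul_of_nonneg_left hδ₃ hn'.le
      linarith
    have a3 := mul_le_mul_of_nonneg_left hNr'
      (by positivity : (0 : ℝ) ≤ 2 * 2 ^ (-(n * δ)))
    linarith
  have e₁ : n * |V₁| / (n * δ) ^ 2 + n * V₂ / (n * δ) ^ 2 + n * V₂ / (n * δ) ^ 2 =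
      (|V₁| + V₂ + V₂) / δ ^ 2 / n := by
    field_simp
  rw [mul_add]
  linarith

/-- Every rate below `R₁₂(p)` is achievable with a conference that the first receiver starts. -/
theorem achievable_of_lt_R12 [Nonempty 𝓧] {W : 𝓧 → 𝓐 × 𝓑 → ℝ}
    (hW : ∀ x, W x ∈ stdSimplex ℝ (𝓐 × 𝓑)) {p : 𝓧 → ℝ} (hp : p ∈ stdSimplex ℝ 𝓧) {C C' R : ℝ}
    (hC : 0 ≤ C) (hC' : 0 ≤ C') (hR : R < R12 W C C' p) : Achievable W C C' R := by
  obtain ⟨V, D, δ, hδ, h⟩ := exists_codes_errProb_le hW hp hC hC' hR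
  have h' : ∀ n : ℕ, ∃ c : Code 𝓧 𝓐 𝓑 n ⌈(2 : ℝ) ^ (n * R)⌉₊ ⌊(2 : ℝ) ^ (n * C)⌋₊
      ⌊(2 : ℝ) ^ (n * C')⌋₊, 0 < n → c.errProb W ≤ V / n + D * (2 ^ (-δ)) ^ n := by
    intro n
    rcases Nat.eq_zero_or_pos n with rfl | hn
    · have k1 : 0 < ⌈(2 : ℝ) ^ (((0 : ℕ) : ℝ) * R)⌉₊ := by simp
      have k2 : 0 < ⌊(2 : ℝ) ^ (((0 : ℕ) : ℝ) * C)⌋₊ := by simp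
      have k3 : 0 < ⌊(2 : ℝ) ^ (((0 : ℕ) : ℝ) * C')⌋₊ := by simp
      exact ⟨⟨fun _ _ => Classical.arbitrary 𝓧, fun _ => ⟨0, k2⟩, fun _ _ => ⟨0, k3⟩,
        fun _ _ => ⟨0, k1⟩, fun _ _ => ⟨0, k1⟩⟩, fun h => absurd h (lt_irrefl _)⟩
    · obtain ⟨c, hc⟩ := h n hn
      exact ⟨c, fun _ => hc⟩
  choose c hc using h'
  refine ⟨c, ?_⟩
  have hlim : Tendsto (fun n : ℕ => V / n + D * ((2 : ℝ) ^ (-δ)) ^ n) atTop (𝓝 (0 + D * 0)) := by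
    refine (tendsto_const_div_atTop_nhds_zero_nat V).add (Tendsto.const_mul D ?_)
    exact tendsto_pow_atTop_nhds_zero_of_lt_one (by positivity)
      (Real.rpow_lt_one_of_one_lt_of_neg one_lt_two (neg_lt_zero.2 hδ))
  rw [mul_zero, add_zero] at hlim
  refine tendsto_of_tendsto_of_tendsto_of_le_of_le' tendsto_const_nhds hlim
    (Eventually.of_forall fun n => errProb_nonneg hW _) ?_
  filter_upwards [eventually_gt_atTop 0] with n hn using hc n hn

omit [Fintype 𝓧] in
lemma swapChannel_mem {W : 𝓧 → 𝓐 × 𝓑 → ℝ} (hW : ∀ x, W x ∈ stdSimplex ℝ (𝓐 × 𝓑)) (x : 𝓧) :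
    swapChannel W x ∈ stdSimplex ℝ (𝓑 × 𝓐) :=
  ⟨fun _ => (hW x).1 _, ((Equiv.prodComm 𝓑 𝓐).sum_comp (W x)).trans (hW x).2⟩

lemma R12_swapChannel (W : 𝓧 → 𝓐 × 𝓑 → ℝ) (C₁₂ C₂₁ : ℝ) (p : 𝓧 → ℝ) :
    R12 (swapChannel W) C₂₁ C₁₂ p = R21 W C₁₂ C₂₁ p :=
  tsRate_equiv ((Equiv.refl 𝓧).prodCongr (Equiv.prodComm 𝓑 𝓐)) (jointLaw W p) (fun ω => ω.1)
    (fun ω => ω.2.2) (fun ω => ω.2.1) C₂₁ C₁₂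

end Achievability

end CoopBC

theorem mainTheorem5 {𝓧 𝓨₁ 𝓨₂ : Type*} [Fintype 𝓧] [Nonempty 𝓧] [Fintype 𝓨₁] [Fintype 𝓨₂]
    (W : 𝓧 → 𝓨₁ × 𝓨₂ → ℝ) (hW : ∀ x, W x ∈ stdSimplex ℝ (𝓨₁ × 𝓨₂))
    (C₁₂ C₂₁ : ℝ) (hC₁₂ : 0 ≤ C₁₂) (hC₂₁ : 0 ≤ C₂₁) :
    -- the erasure assignment in the one-cycle rate expression gives `R₁₂` and `R₂₁`
    (∀ p ∈ stdSimplex ℝ 𝓧,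
      IsGreatest (CoopBC.eafValues (CoopBC.jointLaw W p)
        (fun ω => ω.1) (fun ω => ω.2.1) (fun ω => ω.2.2) C₁₂ C₂₁) (CoopBC.R12 W C₁₂ C₂₁ p) ∧
      IsGreatest (CoopBC.eafValues (CoopBC.jointLaw W p)
        (fun ω => ω.1) (fun ω => ω.2.2) (fun ω => ω.2.1) C₂₁ C₁₂) (CoopBC.R21 W C₁₂ C₂₁ p)) ∧
    -- the suprema below are finite
    BddAbove (Set.range fun p : stdSimplex ℝ 𝓧 => CoopBC.R12 W C₁₂ C₂₁ p.1) ∧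
    BddAbove (Set.range fun p : stdSimplex ℝ 𝓧 => CoopBC.R21 W C₁₂ C₂₁ p.1) ∧
    -- `sup min {R₁₂, R₂₁}` is achievable, whichever receiver starts the conference
    (∀ R : ℝ,
      R < ⨆ p : stdSimplex ℝ 𝓧, min (CoopBC.R12 W C₁₂ C₂₁ p.1) (CoopBC.R21 W C₁₂ C₂₁ p.1) →
      CoopBC.AchievableStart1 W C₁₂ C₂₁ R ∧ CoopBC.AchievableStart2 W C₁₂ C₂₁ R) ∧
    -- the rates for each order of the conference
    (∀ R : ℝ, R < ⨆ p : stdSimplex ℝ 𝓧, CoopBC.R12 W C₁₂ C₂₁ p.1 →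
      CoopBC.AchievableStart1 W C₁₂ C₂₁ R) ∧
    (∀ R : ℝ, R < ⨆ p : stdSimplex ℝ 𝓧, CoopBC.R21 W C₁₂ C₂₁ p.1 →
      CoopBC.AchievableStart2 W C₁₂ C₂₁ R) ∧
    -- hence `sup max {R₁₂, R₂₁}` is achievable if the order may be chosen
    (∀ R : ℝ,
      R < ⨆ p : stdSimplex ℝ 𝓧, max (CoopBC.R12 W C₁₂ C₂₁ p.1) (CoopBC.R21 W C₁₂ C₂₁ p.1) →
      CoopBC.AchievableStart1 W C₁₂ C₂₁ R ∨ CoopBC.AchievableStart2 W C₁₂ C₂₁ R) := by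
  classical
  have hne : Nonempty (stdSimplex ℝ 𝓧) :=
    ⟨⟨_, single_mem_stdSimplex ℝ (Classical.arbitrary 𝓧)⟩⟩
  have h12 : ∀ p ∈ stdSimplex ℝ 𝓧, ∀ R, R < CoopBC.R12 W C₁₂ C₂₁ p →
      CoopBC.AchievableStart1 W C₁₂ C₂₁ R := fun p hp R hR =>
    CoopBC.achievable_of_lt_R12 hW hp hC₁₂ hC₂₁ hR
  have h21 : ∀ p ∈ stdSimplex ℝ 𝓧, ∀ R, R < CoopBC.R21 W C₁₂ C₂₁ p →
      CoopBC.AchievableStart2 W C₁₂ C₂₁ R := fun p hp R hR =>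
    CoopBC.achievable_of_lt_R12 (CoopBC.swapChannel_mem hW) hp hC₂₁ hC₁₂
      (hR.trans_eq (CoopBC.R12_swapChannel W C₁₂ C₂₁ p).symm)
  refine ⟨fun p hp => ?_, ?_, ?_, fun R hR => ?_, fun R hR => ?_, fun R hR => ?_, fun R hR => ?_⟩
  · have hμ := CoopBC.jointLaw_nonneg hW hp
    have h1 := CoopBC.sum_jointLaw hW hp
    exact ⟨CoopBC.isGreatest_eafValues hμ h1 _ _ _ hC₁₂ hC₂₁,
      CoopBC.isGreatest_eafValues hμ h1 _ _ _ hC₂₁ hC₁₂⟩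
  · refine ⟨Fintype.card 𝓧 * (1 / Real.log 2) + C₂₁, ?_⟩
    rintro _ ⟨p, rfl⟩
    exact CoopBC.tsRate_le (CoopBC.jointLaw_nonneg hW p.2) _ _ _ _ _
  · refine ⟨Fintype.card 𝓧 * (1 / Real.log 2) + C₁₂, ?_⟩
    rintro _ ⟨p, rfl⟩
    exact CoopBC.tsRate_le (CoopBC.jointLaw_nonneg hW p.2) _ _ _ _ _
  · obtain ⟨p, hp⟩ := exists_lt_of_lt_ciSup hR
    exact ⟨h12 p.1 p.2 R (lt_min_iff.1 hp).1, h21 p.1 p.2 R (lt_min_iff.1 hp).2⟩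
  · obtain ⟨p, hp⟩ := exists_lt_of_lt_ciSup hR
    exact h12 p.1 p.2 R hp
  · obtain ⟨p, hp⟩ := exists_lt_of_lt_ciSup hR
    exact h21 p.1 p.2 R hp
  · obtain ⟨p, hp⟩ := exists_lt_of_lt_ciSup hR
    exact (lt_max_iff.1 hp).imp (h12 p.1 p.2 R) (h21 p.1 p.2 R)
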